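/- Write $\ell_0=x$, $\ell=\ell_1=\frac1{-\log x}$, $\ell_{j+1}=\ell\circ\ell_j$. Let $\widehat{\mathcal L}_j^\infty$ be the set of transseries $$\sum_{i_0\ge 0}\sum_{i_1\ge 0}\cdots\sum_{i_j\ge 0}a_{i_0\ldots i_j}\,x^{\alpha_{i_0}}\ell^{\alpha_{i_0i_1}}\cdots\ell_j^{\alpha_{i_0\cdots i_j}},\qquad a_{i_0\ldots i_j}\in\mathbb R,$$ where for every $k\le j$ and all $i_0,\dots,i_{k-1}$ the sequence $(\alpha_{i_0\cdots i_k})_{i_k}$ of real numbers is strictly increasing and tends to $+\infty$; let $\widehat{\mathcal L}_j$ be the subset of those with only positive powers of $x$, and let $\widehat{\mathcal L}\subset\widehat{\mathcal L}_1$ and $\widehat{\mathcal L}^\infty\subset\widehat{\mathcal L}_1^\infty$ be the subsets of those with only integer powers of $\ell$. Exponents are ordered lexicographically, and the leading term of a transseries is the one with the smallest exponent. Let $\widehat g\in\widehat{\mathcal L}$, $$\widehat g=a\,x^\alpha\ell^m+\text{h.o.t.},\qquad a>0,\ \alpha>0,\ m\in\mathbb Z,$$ and let $\mathcal S(\widehat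 g)\subset\mathbb R_{>0}\times\mathbb Z$ be the set of the exponents $(\beta,l)$ of the monomials $x^\beta\ell^l$ that occur in $\widehat g$. If $m\ne0$, let $\widetilde{\mathcal R}$ be the sub-semigroup of $\mathbb R_{\ge0}\times\mathbb Z\times\mathbb Z$ generated by $(\beta-\alpha,l-m,0)$ for $(\beta,l)\in\mathcal S(\widehat g)\setminus\{(\alpha,m)\}$ together with $(0,1,-1)$ and $(0,0,1)$. If $m=0$, let $\widetilde{\mathcal R}$ be the sub-semigroup of $\mathbb R_{\ge0}\times\mathbb Z$ generated by $(\beta-\alpha,l)$ for $(\beta,l)\in\mathcal S(\widehat g)\setminus\{(\alpha,0)\}$ together with $(0,1)$. Then $\widehat g$ has a unique two-sided inverse $\widehat g^{-1}$ with respect to formal composition of power-iterated logarithm transseries, and $\widehat g^{-1}\in\widehat{\mathcal L}_2$; if $m=0$, then $\widehat g^{-1}\in\widehat{\mathcal L}$. More precisely: 1. If $m\neq0$, then $$\widehat g^{-1}(x)=(a\alpha^m)^{-\frac1\alpha}\,(x\ell^{-m})^{\frac1\alpha}\,\bigl(1+\widehat R(x)\bigr),$$ where $\widehat R\in\widehat{\mathcal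 L}_2^\infty$, every exponent of $\widehat R$ is lexicographically greater than $(0,0,0)$, and the support of $\widehat R$ consists of monomials of the form $(x\ell^{-m})^{\frac\gamma\alpha}\ell^r\ell_2^s$ with $(\gamma,r,s)\in\widetilde{\mathcal R}$. 2. If $m=0$, then $$\widehat g^{-1}(x)=a^{-\frac1\alpha}\,x^{\frac1\alpha}\,\bigl(1+\widehat R(x)\bigr),$$ where $\widehat R\in\widehat{\mathcal L}^\infty$, every exponent of $\widehat R$ is lexicographically greater than $(0,0)$, and the support of $\widehat R$ consists of monomials of the form $x^{\frac\gamma\alpha}\ell^r$ with $(\gamma,r)\in\widetilde{\mathcal R}$. -/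

import Mathlib

noncomputable section

namespace LogTransseries

/-- Exponents of the monomials `x^(γ 0) * ℓ^(γ 1) * ℓ₂^(γ 2) * ⋯` (finitely many nonzero), ordered
lexicographically, the exponent of `x = ℓ₀` coming first. A larger exponent is a smaller monomial
as `x → 0+`. -/
abbrev Exponent : Type := Lex (ℕ →₀ ℝ)

/-- Power-iterated logarithm transseries: real formal sums of monomials with well-ordered support
(and monomials of every depth in iterated logarithms). -/
abbrev Transseries : Type := HahnSeries Exponent ℝ

/-- The exponent of the monomial `ℓ_j ^ r`. -/
def ellExp (j : ℕ) (r : ℝ) : Exponent := toLex (Finsupp.single j r)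

/-- The exponent of the monomial `x ^ a * ℓ ^ b * ℓ₂ ^ c`. -/
def expo (a b c : ℝ) : Exponent := ellExp 0 a + ellExp 1 b + ellExp 2 c

/-- The identity transseries `x`. -/
def idT : Transseries := HahnSeries.single (ellExp 0 1) 1

/-! ### The classes of transseries -/

/-- `S` consists of terms of a strictly increasing sequence of reals that tends to `+∞`. -/
def IsSequential (S : Set ℝ) : Prop :=
  ∃ u : ℕ → ℝ, StrictMono u ∧ Filter.Tendsto u Filter.atTop Filter.atTop ∧ S ⊆ Set.range u

/-- The class of the transseries
`∑_{i₀} ∑_{i₁} ⋯ ∑_{i_j} a_{i₀…i_j} x^{α_{i₀}} ℓ^{α_{i₀i₁}} ⋯ ℓ_j^{α_{i₀…i_j}}` in which, for each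
`k ≤ j` and each choice of `i₀, …, i_{k-1}`, the exponents `α_{i₀…i_k}` of `ℓ_k` form a strictly
increasing sequence in `i_k` tending to `+∞`. The choice of `i₀, …, i_{k-1}` is here the choice of
the exponents `p 0, …, p (k-1)` of `ℓ₀, …, ℓ_{k-1}`. -/
def LInfty (j : ℕ) : Set Transseries :=
  {f | (∀ n ∈ f.support, ∀ k, j < k → ofLex n k = 0) ∧
    ∀ k ≤ j, ∀ p : ℕ → ℝ,
      IsSequential {t | ∃ n ∈ f.support, (∀ i < k, ofLex n i = p i) ∧ ofLex n k = t}}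

/-- The infinitesimal transseries of `LInfty j`: only positive powers of `x`. -/
def LFin (j : ℕ) : Set Transseries :=
  {f ∈ LInfty j | ∀ n ∈ f.support, 0 < ofLex n 0}

/-- The elements of `LInfty 1` with only integer powers of `ℓ`. -/
def LHatInfty : Set Transseries :=
  {f ∈ LInfty 1 | ∀ n ∈ f.support, ∃ z : ℤ, ofLex n 1 = z}

/-- The elements of `LFin 1` with only integer powers of `ℓ`. -/
def LHat : Set Transseries :=
  {f ∈ LFin 1 | ∀ n ∈ f.support, ∃ z : ℤ, ofLex n 1 = z}

/-! ### Formal composition -/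

/-- A transseries that may be substituted for `x`: positive leading coefficient, and leading
monomial tending to `0`. -/
def IsPosInfinitesimal (h : Transseries) : Prop :=
  0 < h.leadingCoeff ∧ 0 < h.order

/-- The `ε` in `u = c * M * (1 + ε)`, where `c * M` is the leading term of `u`. -/
def relRem (u : Transseries) : Transseries :=
  HahnSeries.single (-u.order) (u.leadingCoeff)⁻¹ * u - 1

/-- `u ^ r = c ^ r * M ^ r * (1 + ε) ^ r`, for `u = c * M * (1 + ε)` with `c > 0`; the last factor
is the binomial series in `ε`. -/
def rpow (u : Transseries) (r : ℝ) : Transseries :=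
  HahnSeries.single (toLex (r • ofLex u.order)) (u.leadingCoeff ^ r) *
    PowerSeries.heval (relRem u) (PowerSeries.binomialSeries ℝ r)

/-- `log u = log c + log M + log (1 + ε)`, for `u = c * M * (1 + ε)` with `c > 0`; the last term is
the logarithmic series in `ε`, and `log ℓ_j = - 1 / ℓ_{j+1}`, so that
`log M = - ∑ j, γ j * ℓ_{j+1}⁻¹` for `M = ∏ j, ℓ_j ^ γ j`. -/
def log (u : Transseries) : Transseries :=
  HahnSeries.C (Real.log u.leadingCoeff) -
    (ofLex u.order).sum (fun j r => HahnSeries.single (ellExp (j + 1) (-1)) r) +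
    PowerSeries.heval (relRem u) (PowerSeries.log ℝ)

/-- `ℓ_j ∘ h`: `ℓ₀ ∘ h = h` and `ℓ_{j+1} ∘ h = 1 / (- log (ℓ_j ∘ h))`. -/
def ellComp (h : Transseries) : ℕ → Transseries
  | 0 => h
  | j + 1 => (-log (ellComp h j))⁻¹

/-- The composition with `h` of the monomial with exponent `n`, that is
`∏ j, (ℓ_j ∘ h) ^ n j`. -/
def monomialComp (h : Transseries) (n : Exponent) : Transseries :=
  (ofLex n).prod fun j r => rpow (ellComp h j) r

/-- `k` is the formal composition `f ∘ h`: `h` may be substituted for `x`, the family of the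
`f_n * (monomial n ∘ h)` is formally summable, and its sum is `k`. -/
def IsComp (f h k : Transseries) : Prop :=
  IsPosInfinitesimal h ∧
    ∃ s : HahnSeries.SummableFamily Exponent ℝ Exponent,
      (∀ n, s n = f.coeff n • monomialComp h n) ∧ s.hsum = k

/-- `h` is a (two-sided) inverse of `g` for formal composition. -/
def IsFormalInverse (g h : Transseries) : Prop :=
  IsComp g h idT ∧ IsComp h g idT

/-! ### The semigroup of exponents -/

/-- The pairs `(β, l)` such that `x ^ β * ℓ ^ l` occurs in `g`. -/
def supp (g : Transseries) : Set (ℝ × ℤ) :=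
  {p | g.coeff (expo p.1 p.2 0) ≠ 0}

/-- The semigroup of exponents for the leading monomial `x ^ α * ℓ ^ m`, `m ≠ 0`. -/
def semigroup (g : Transseries) (α : ℝ) (m : ℤ) : AddSubsemigroup (ℝ × ℤ × ℤ) :=
  AddSubsemigroup.closure
    ({q | ∃ p ∈ supp g \ {(α, m)}, q = (p.1 - α, p.2 - m, 0)} ∪ {(0, 1, -1), (0, 0, 1)})

/-- The semigroup of exponents for the leading monomial `x ^ α`. -/
def semigroupZero (g : Transseries) (α : ℝ) : AddSubsemigroup (ℝ × ℤ) :=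
  AddSubsemigroup.closure
    ({q | ∃ p ∈ supp g \ {(α, 0)}, q = (p.1 - α, p.2)} ∪ {(0, 1)})

end LogTransseries

end

noncomputable section

namespace LogTransseries

open HahnSeries PowerSeries SummableFamily

/-! ### Real powers and logarithms of `1 + e` in Hahn series -/

section Powers

variable {Γ : Type*} [AddCommGroup Γ] [LinearOrder Γ]

/-! Composition on the right with `g` is a strongly linear ring endomorphism that sends each
monomial to a series with a known leading monomial, the map of leading exponents being a
lexicographically increasing bijection (`leadExp`). Finding `h` with `h ∘ g = x` is thus a
triangular linear system for the coefficients of `h`, solved by well-founded recursion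
(`exists_triangular_solution`, `HasLeading.exists_left_inverse`).

The support comes from the same recursion. Let `M` be a well-ordered monoid of nonnegative exponents
containing the relative exponents of `g`, `ℓ ∘ g` and, where it matters, `ℓ₂ ∘ g`. Then the system
closes up over `M`, and `h` is supported in a shifted image of `M` under the inverse of `leadExp`.
Since `-log g = α ℓ⁻¹ (1 + ⋯)`, where the dots involve `ℓ`, `m ℓ ℓ₂⁻¹` and `ℓ log (1 + ε)`, a
suitable `M` is generated by the exponents of `g` with those of `ℓ ℓ₂⁻¹` and `ℓ₂`, or with that of
`ℓ` alone if `m = 0`; this is the semigroup of the statement together with zero.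

A left inverse is also a right inverse: composition with `g` is injective, being a ring homomorphism
out of a field, and `(g ∘ h) ∘ g = g ∘ (h ∘ g) = g` (`isFormalInverse_of_hom_eq`). This
associativity requires the endomorphism to commute with real powers and logarithms
(`HasLeading.hom_rpow`, `HasLeading.hom_log`), hence the laws of powers. These hold because each
coefficient of `(1 + e) ^ r` is a polynomial in `r`, determined by its values at natural `r`; its
derivative at `0` gives the logarithm. Uniqueness, among transseries of every depth, compares
leading terms (`IsComp.left_unique`). -/

theorem pos_of_mem_support {e : HahnSeries Γ ℝ} (he : 0 < e.orderTop) {n : Γ}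
    (hn : n ∈ e.support) : 0 < n :=
  WithTop.coe_pos.mp (he.trans_le (orderTop_le_of_coeff_ne_zero hn))

theorem orderTop_pos_iff {e : HahnSeries Γ ℝ} : 0 < e.orderTop ↔ ∀ n ∈ e.support, 0 < n := by
  refine ⟨fun h n hn => pos_of_mem_support h hn, fun h => ?_⟩
  by_cases h0 : e = 0
  · simp [h0]
  · exact (zero_lt_orderTop_iff h0).2 (h _ (by simpa using h0))

variable [IsOrderedAddMonoid Γ]

/-- The series supported in an additive submonoid form a subalgebra. -/
def supportedIn (M : AddSubmonoid Γ) : Subalgebra ℝ (HahnSeries Γ ℝ) where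
  carrier := {f | f.support ⊆ M}
  mul_mem' {f g} hf hg := by
    refine (support_mul_subset).trans ?_
    rintro _ ⟨a, ha, b, hb, rfl⟩
    exact M.add_mem (hf ha) (hg hb)
  add_mem' {f g} hf hg := (support_add_subset f g).trans (Set.union_subset hf hg)
  algebraMap_mem' r := by
    intro a ha
    rw [← HahnSeries.C_eq_algebraMap] at ha
    have : a = 0 := eq_of_mem_support_single ha
    rw [this]; exact M.zero_mem

theorem single_mem_supportedIn {M : AddSubmonoid Γ} {n : Γ} (hn : n ∈ M) (r : ℝ) :
    single n r ∈ supportedIn M := fun a ha => by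
  rw [eq_of_mem_support_single ha]; exact hn

theorem heval_mem_supportedIn {M : AddSubmonoid Γ} {e : HahnSeries Γ ℝ} (he : e ∈ supportedIn M)
    (f : PowerSeries ℝ) : heval e f ∈ supportedIn M := by
  rw [heval_apply]
  refine support_hsum_subset.trans (Set.iUnion_subset fun i => ?_)
  have : powerSeriesFamily e f i ∈ supportedIn M := by
    by_cases h : 0 < e.orderTop
    · rw [powerSeriesFamily_of_orderTop_pos h]
      exact Subalgebra.smul_mem _ (Subalgebra.pow_mem _ he _) _
    -- By convention, evaluation at a series that is not infinitesimal is evaluation at `0`.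
    · rw [powerSeriesFamily_of_not_orderTop_pos h, powerSeriesFamily_of_orderTop_pos (by simp)]
      exact Subalgebra.smul_mem _ (Subalgebra.pow_mem _ (Subalgebra.zero_mem _) _) _
  exact this

theorem orderTop_heval_pos {e : HahnSeries Γ ℝ} (he : 0 < e.orderTop) {f : PowerSeries ℝ}
    (hf : constantCoeff f = 0) : 0 < (heval e f).orderTop := by
  refine orderTop_pos_iff.2 fun n hn => lt_of_le_of_ne ?_ ?_
  · exact heval_mem_supportedIn (M := AddSubmonoid.nonneg Γ)
      (fun m hm => (pos_of_mem_support he hm).le) f hn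
  · rintro rfl
    exact hn (by rw [coeff_heval_zero, hf])

theorem orderTop_heval_sub_one_pos {e : HahnSeries Γ ℝ} (he : 0 < e.orderTop) {f : PowerSeries ℝ}
    (hf : constantCoeff f = 1) : 0 < (heval e f - 1).orderTop := by
  rw [← map_one (heval e), ← map_sub]
  exact orderTop_heval_pos he (by simp [hf])

/-- The binomial coefficient `r ↦ r.choose n` as a polynomial. -/
def choosePoly (n : ℕ) : Polynomial ℝ :=
  Polynomial.C ((n.factorial : ℝ)⁻¹) * descPochhammer ℝ n

theorem eval_choosePoly (n : ℕ) (r : ℝ) : (choosePoly n).eval r = Ring.choose r n := by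
  rw [Ring.choose_eq_smul, choosePoly, Polynomial.eval_C_mul, smul_eq_mul,
    ← Polynomial.aeval_eq_smeval, Polynomial.aeval_def, ← Polynomial.eval_map, descPochhammer_map]

/-- Formally `log (1 + X)` is the derivative of `(1 + X) ^ r` at `r = 0`. With the factor `r` split
off, the derivative of the falling factorial of length `n + 1` at `0` is the falling factorial of
length `n` at `-1`, that is `(-1) ^ n * n!`. -/
theorem derivative_choosePoly (n : ℕ) :
    (choosePoly n).derivative.eval 0 = PowerSeries.coeff n (PowerSeries.log ℝ) := by
  cases n with
  | zero => simp [choosePoly]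
  | succ n =>
    have h : (descPochhammer ℝ n).eval (-1) = (-1) ^ n * n.factorial := by
      have h1 := eval_choosePoly n (-1)
      rw [choosePoly, Polynomial.eval_C_mul, inv_mul_eq_iff_eq_mul₀ (by positivity)] at h1
      rw [h1, mul_comm]
      congr 1
      rw [Ring.choose_neg]
      have : Ring.choose (1 + (n : ℝ) - 1) n = 1 := by
        rw [show (1 + (n : ℝ) - 1) = (n : ℕ) by ring, Ring.choose_natCast]; simp
      rw [this, Units.smul_def]
      simp
    rw [choosePoly, Polynomial.derivative_C_mul, Polynomial.eval_C_mul, descPochhammer_succ_left,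
      Polynomial.derivative_mul]
    simp only [Polynomial.derivative_X, one_mul, Polynomial.eval_add, Polynomial.eval_comp,
      Polynomial.eval_mul, Polynomial.eval_X, zero_mul, add_zero, Polynomial.eval_sub,
      Polynomial.eval_one, zero_sub, h, PowerSeries.coeff_log, Nat.factorial_succ]
    have : ((n + 1 : ℕ) : ℝ) ≠ 0 := by positivity
    have : (n.factorial : ℝ) ≠ 0 := by positivity
    simp
    field_simp
    ring

/-- The finite index set depends on `e`, `d` and `p` but not on `f` and `g`; hence the coefficient
is a polynomial in `r` when `f` and `g` are binomial series. -/
theorem coeff_heval_mul_heval (e d : HahnSeries Γ ℝ) (f g : PowerSeries ℝ) (p : Γ) :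
    (heval e f * heval d g).coeff p =
      ∑ i ∈ (((powers e).mul (powers d)).coeff p).support,
        f.coeff i.1 * g.coeff i.2 * (powers e i.1 * powers d i.2).coeff p := by
  rw [heval_apply, heval_apply, ← hsum_mul]
  rw [coeff_hsum_eq_sum_of_subset (t := (((powers e).mul (powers d)).coeff p).support)]
  · refine Finset.sum_congr rfl fun i _ => ?_
    simp only [mul_toFun, smulFamily_toFun, smul_mul_smul_comm, HahnSeries.coeff_smul, smul_eq_mul]
  · intro i hi
    rw [Finset.mem_coe, Finsupp.mem_support_iff]
    intro h0
    apply hi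
    have : (powers e i.1 * powers d i.2).coeff p = 0 := h0
    simp only [mul_toFun, smulFamily_toFun, smul_mul_smul_comm, HahnSeries.coeff_smul, this,
        smul_zero]

/-- The coefficients of `(1 + e) ^ r * (1 + d) ^ r` are polynomials in `r`. -/
theorem exists_polynomial_coeff_mul (e d : HahnSeries Γ ℝ) (p : Γ) : ∃ P : Polynomial ℝ,
    (∀ r : ℝ, (heval e (binomialSeries ℝ r) * heval d (binomialSeries ℝ r)).coeff p = P.eval r) ∧
    P.derivative.eval 0 = (heval e (PowerSeries.log ℝ) + heval d (PowerSeries.log ℝ)).coeff p := by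
  refine ⟨∑ i ∈ (((powers e).mul (powers d)).coeff p).support,
    Polynomial.C ((powers e i.1 * powers d i.2).coeff p) * (choosePoly i.1 * choosePoly i.2),
    fun r => ?_, ?_⟩
  · rw [coeff_heval_mul_heval, Polynomial.eval_finsetSum]
    refine Finset.sum_congr rfl fun i _ => ?_
    simp [eval_choosePoly, mul_comm]
  · have h1 := coeff_heval_mul_heval e d (PowerSeries.log ℝ) 1 p
    have h2 := coeff_heval_mul_heval e d 1 (PowerSeries.log ℝ) p
    rw [map_one, mul_one] at h1
    rw [map_one, one_mul] at h2
    rw [HahnSeries.coeff_add, h1, h2, Polynomial.derivative_sum, Polynomial.eval_finsetSum,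
      ← Finset.sum_add_distrib]
    refine Finset.sum_congr rfl fun i _ => ?_
    have h0 : ∀ n, (choosePoly n).eval 0 = PowerSeries.coeff n (1 : PowerSeries ℝ) := fun n => by
      rw [eval_choosePoly, Ring.choose_zero_ite, PowerSeries.coeff_one]
    rw [Polynomial.derivative_C_mul, Polynomial.eval_C_mul, Polynomial.derivative_mul]
    simp only [Polynomial.eval_add, Polynomial.eval_mul, derivative_choosePoly, h0]
    ring

theorem exists_polynomial_coeff (e : HahnSeries Γ ℝ) (p : Γ) : ∃ P : Polynomial ℝ,
    (∀ r : ℝ, (heval e (binomialSeries ℝ r)).coeff p = P.eval r) ∧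
    P.derivative.eval 0 = (heval e (PowerSeries.log ℝ)).coeff p := by
  have hz : ∀ f : PowerSeries ℝ, heval (0 : HahnSeries Γ ℝ) f = constantCoeff f • 1 := fun f =>
    powerSeriesFamily_hsum_zero f
  simpa [hz] using exists_polynomial_coeff_mul e 0 p

theorem polynomial_eq_of_eval_natCast {P Q : Polynomial ℝ}
    (h : ∀ n : ℕ, P.eval (n : ℝ) = Q.eval (n : ℝ)) :
    P = Q :=
  Polynomial.eq_of_infinite_eval_eq P Q
    ((Set.infinite_range_of_injective Nat.cast_injective).mono (by rintro _ ⟨n, rfl⟩; exact h n))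

theorem heval_binomialSeries_natCast {e : HahnSeries Γ ℝ} (he : 0 < e.orderTop) (n : ℕ) :
    heval e (binomialSeries ℝ (n : ℝ)) = (1 + e) ^ n := by
  rw [binomialSeries_nat, map_pow, map_add, map_one, heval_X e he]

theorem orderTop_add_add_mul_pos {e d : HahnSeries Γ ℝ} (he : 0 < e.orderTop)
    (hd : 0 < d.orderTop) :
    0 < (e + d + e * d).orderTop := by
  have h : 0 < (e * d).orderTop := by
    rw [orderTop_mul]; exact he.trans_le (le_add_of_nonneg_right hd.le)
  exact (lt_min (lt_min he hd) h).trans_le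
    ((min_le_min_right _ min_orderTop_le_orderTop_add).trans min_orderTop_le_orderTop_add)

/-- `((1 + e) * (1 + d)) ^ r = (1 + e) ^ r * (1 + d) ^ r`, and the same for the logarithm. -/
theorem heval_binomialSeries_mul_and_log {e d : HahnSeries Γ ℝ} (he : 0 < e.orderTop)
    (hd : 0 < d.orderTop) :
    (∀ r : ℝ, heval (e + d + e * d) (binomialSeries ℝ r) =
      heval e (binomialSeries ℝ r) * heval d (binomialSeries ℝ r)) ∧
    heval (e + d + e * d) (PowerSeries.log ℝ) =
      heval e (PowerSeries.log ℝ) + heval d (PowerSeries.log ℝ) := by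
  have key : ∀ p : Γ, (∀ r : ℝ, (heval (e + d + e * d) (binomialSeries ℝ r)).coeff p =
      (heval e (binomialSeries ℝ r) * heval d (binomialSeries ℝ r)).coeff p) ∧
      (heval (e + d + e * d) (PowerSeries.log ℝ)).coeff p =
      (heval e (PowerSeries.log ℝ) + heval d (PowerSeries.log ℝ)).coeff p := by
    intro p
    obtain ⟨P, hP, hP'⟩ := exists_polynomial_coeff (e + d + e * d) p
    obtain ⟨Q, hQ, hQ'⟩ := exists_polynomial_coeff_mul e d p
    -- At natural exponents both sides are ordinary powers.
    have : P = Q := polynomial_eq_of_eval_natCast fun n => by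
      rw [← hP, ← hQ, heval_binomialSeries_natCast (orderTop_add_add_mul_pos he hd),
        heval_binomialSeries_natCast he, heval_binomialSeries_natCast hd, ← mul_pow]
      congr 2; ring
    subst this
    exact ⟨fun r => by rw [hP, hQ], by rw [← hP', ← hQ']⟩
  exact ⟨fun r => by ext p; exact (key p).1 r, by ext p; exact (key p).2⟩

/-- `((1 + e) ^ r) ^ s = (1 + e) ^ (r * s)` and `log ((1 + e) ^ r) = r * log (1 + e)`. -/
theorem heval_binomialSeries_pow_and_log {e : HahnSeries Γ ℝ} (he : 0 < e.orderTop) (r : ℝ) :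
    (∀ s : ℝ, heval (heval e (binomialSeries ℝ r) - 1) (binomialSeries ℝ s) =
      heval e (binomialSeries ℝ (r * s))) ∧
    heval (heval e (binomialSeries ℝ r) - 1) (PowerSeries.log ℝ) =
      r • heval e (PowerSeries.log ℝ) := by
  have hpos := orderTop_heval_sub_one_pos he (binomialSeries_constantCoeff (A := ℝ) r)
  have key : ∀ p : Γ, (∀ s : ℝ, (heval (heval e (binomialSeries ℝ r) - 1)
      (binomialSeries ℝ s)).coeff p = (heval e (binomialSeries ℝ (r * s))).coeff p) ∧
      (heval (heval e (binomialSeries ℝ r) - 1) (PowerSeries.log ℝ)).coeff p =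
      (r • heval e (PowerSeries.log ℝ)).coeff p := by
    intro p
    obtain ⟨P, hP, hP'⟩ := exists_polynomial_coeff (heval e (binomialSeries ℝ r) - 1) p
    obtain ⟨Q, hQ, hQ'⟩ := exists_polynomial_coeff e p
    -- The substitution `s ↦ r * s` in the second polynomial; the chain rule at `s = 0` then
    -- produces the factor `r` in the logarithm.
    have : P = Q.comp (Polynomial.C r * Polynomial.X) := polynomial_eq_of_eval_natCast fun n => by
      rw [← hP, Polynomial.eval_comp, Polynomial.eval_C_mul, Polynomial.eval_X, ← hQ,
        heval_binomialSeries_natCast hpos, add_sub_cancel, ← map_pow]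
      congr 2
      clear hP hQ hP' hQ'
      induction n with
      | zero => simp
      | succ n ih => rw [pow_succ, ih, Nat.cast_succ, mul_add, mul_one, binomialSeries_add]
    subst this
    refine ⟨fun s => by rw [hP, hQ, Polynomial.eval_comp]; simp, ?_⟩
    rw [← hP', HahnSeries.coeff_smul, ← hQ', Polynomial.derivative_comp]
    simp
  exact ⟨fun s => by ext p; exact (key p).1 s, by ext p; exact (key p).2⟩

end Powers

/-! ### Laws of powers and logarithms of transseries -/

section Laws

theorem add_smul_exponent (r s : ℝ) (n : Exponent) : (r + s) • n = r • n + s • n :=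
  add_smul r s (ofLex n)

theorem zero_smul_exponent (n : Exponent) : (0 : ℝ) • n = 0 :=
  zero_smul ℝ (ofLex n)

theorem eq_single_mul_one_add_relRem {u : Transseries} (hu : u ≠ 0) :
    u = HahnSeries.single u.order u.leadingCoeff * (1 + relRem u) := by
  rw [relRem, add_sub_cancel, ← mul_assoc, single_mul_single, add_neg_cancel,
    mul_inv_cancel₀ (leadingCoeff_ne_zero.2 hu), single_zero_one, one_mul]

theorem orderTop_relRem_pos {u : Transseries} (hu : u ≠ 0) : 0 < (relRem u).orderTop := by
  have hc := leadingCoeff_ne_zero.2 hu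
  rw [relRem, orderTop_self_sub_one_pos_iff]
  constructor
  · rw [orderTop_mul, orderTop_single (inv_ne_zero hc), ← order_eq_orderTop_of_ne_zero hu,
      ← WithTop.coe_add, neg_add_cancel, WithTop.coe_zero]
  · rw [leadingCoeff_mul, leadingCoeff_of_single, inv_mul_cancel₀ hc]

theorem one_add_orderTop_leadingCoeff {e : Transseries} (he : 0 < e.orderTop) :
    (1 + e).orderTop = 0 ∧ (1 + e).leadingCoeff = 1 :=
  (orderTop_self_sub_one_pos_iff (1 + e)).1 (by rwa [add_sub_cancel_left])

theorem one_add_ne_zero_of_pos {e : Transseries} (he : 0 < e.orderTop) : 1 + e ≠ 0 := by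
  rw [← leadingCoeff_ne_zero, (one_add_orderTop_leadingCoeff he).2]; exact one_ne_zero

section Decomposition

variable {n : Exponent} {c : ℝ} {e : Transseries}

theorem leadingCoeff_single_mul (he : 0 < e.orderTop) :
    (HahnSeries.single n c * (1 + e)).leadingCoeff = c := by
  rw [leadingCoeff_mul, leadingCoeff_of_single, (one_add_orderTop_leadingCoeff he).2, mul_one]

theorem order_single_mul (hc : c ≠ 0) (he : 0 < e.orderTop) :
    (HahnSeries.single n c * (1 + e)).order = n := by
  have h : (1 + e).order = 0 := by
    have := order_eq_orderTop_of_ne_zero (one_add_ne_zero_of_pos he)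
    rw [(one_add_orderTop_leadingCoeff he).1] at this
    exact_mod_cast this
  rw [order_mul (single_ne_zero hc) (one_add_ne_zero_of_pos he), order_single hc, h, add_zero]

theorem relRem_single_mul (hc : c ≠ 0) (he : 0 < e.orderTop) :
    relRem (HahnSeries.single n c * (1 + e)) = e := by
  rw [relRem, leadingCoeff_single_mul he, order_single_mul hc he, ← mul_assoc, single_mul_single,
    neg_add_cancel, inv_mul_cancel₀ hc, single_zero_one, one_mul, add_sub_cancel_left]

theorem rpow_single_mul (hc : c ≠ 0) (he : 0 < e.orderTop) (r : ℝ) :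
    rpow (HahnSeries.single n c * (1 + e)) r =
      HahnSeries.single (r • n) (c ^ r) * heval e (binomialSeries ℝ r) := by
  rw [rpow, leadingCoeff_single_mul he, order_single_mul hc he, relRem_single_mul hc he]
  rfl

end Decomposition

variable {u v : Transseries}

theorem ne_zero_of_leadingCoeff_pos (hu : 0 < u.leadingCoeff) : u ≠ 0 :=
  leadingCoeff_ne_zero.1 hu.ne'

theorem rpow_eq (u : Transseries) (r : ℝ) : rpow u r =
    HahnSeries.single (r • u.order) (u.leadingCoeff ^ r) *
      (1 + (heval (relRem u) (binomialSeries ℝ r) - 1)) := by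
  rw [add_sub_cancel]; rfl

theorem orderTop_binomial_pos (hu : u ≠ 0) (r : ℝ) :
    0 < (heval (relRem u) (binomialSeries ℝ r) - 1).orderTop :=
  orderTop_heval_sub_one_pos (orderTop_relRem_pos hu) (binomialSeries_constantCoeff r)

theorem leadingCoeff_rpow (hu : 0 < u.leadingCoeff) (r : ℝ) :
    (rpow u r).leadingCoeff = u.leadingCoeff ^ r := by
  rw [rpow_eq, leadingCoeff_single_mul (orderTop_binomial_pos (ne_zero_of_leadingCoeff_pos hu) r)]

theorem leadingCoeff_rpow_pos (hu : 0 < u.leadingCoeff) (r : ℝ) :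
    0 < (rpow u r).leadingCoeff := by
  rw [leadingCoeff_rpow hu]; exact Real.rpow_pos_of_pos hu r

theorem order_rpow (hu : 0 < u.leadingCoeff) (r : ℝ) : (rpow u r).order = r • u.order := by
  rw [rpow_eq, order_single_mul (Real.rpow_pos_of_pos hu r).ne'
    (orderTop_binomial_pos (ne_zero_of_leadingCoeff_pos hu) r)]

theorem relRem_rpow (hu : 0 < u.leadingCoeff) (r : ℝ) :
    relRem (rpow u r) = heval (relRem u) (binomialSeries ℝ r) - 1 := by
  rw [rpow_eq, relRem_single_mul (Real.rpow_pos_of_pos hu r).ne'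
    (orderTop_binomial_pos (ne_zero_of_leadingCoeff_pos hu) r)]

theorem leadingCoeff_mul_pos (hu : 0 < u.leadingCoeff) (hv : 0 < v.leadingCoeff) :
    0 < (u * v).leadingCoeff := by
  rw [leadingCoeff_mul]; exact mul_pos hu hv

theorem relRem_mul (hu : u ≠ 0) (hv : v ≠ 0) :
    relRem (u * v) = relRem u + relRem v + relRem u * relRem v := by
  have h : u * v = HahnSeries.single (u.order + v.order) (u.leadingCoeff * v.leadingCoeff) *
      (1 + (relRem u + relRem v + relRem u * relRem v)) := by
    conv_lhs => rw [eq_single_mul_one_add_relRem hu, eq_single_mul_one_add_relRem hv]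
    rw [← single_mul_single]; ring
  rw [h, relRem_single_mul (mul_ne_zero (leadingCoeff_ne_zero.2 hu) (leadingCoeff_ne_zero.2 hv))
    (orderTop_add_add_mul_pos (orderTop_relRem_pos hu) (orderTop_relRem_pos hv))]

theorem rpow_zero (u : Transseries) : rpow u 0 = 1 := by
  rw [rpow_eq, zero_smul_exponent, Real.rpow_zero, binomialSeries_zero,
    map_one (heval (relRem u)), sub_self, add_zero, mul_one, single_zero_one]

theorem rpow_one (hu : u ≠ 0) : rpow u 1 = u := by
  conv_rhs => rw [eq_single_mul_one_add_relRem hu]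
  have := heval_binomialSeries_natCast (orderTop_relRem_pos hu) 1
  rw [Nat.cast_one, pow_one] at this
  rw [rpow_eq, this, one_smul, Real.rpow_one, add_sub_cancel]

theorem rpow_add (hu : 0 < u.leadingCoeff) (r s : ℝ) :
    rpow u (r + s) = rpow u r * rpow u s := by
  rw [rpow_eq, rpow_eq, rpow_eq, add_sub_cancel, add_sub_cancel, add_sub_cancel, add_smul_exponent,
    Real.rpow_add hu, ← single_mul_single, binomialSeries_add, map_mul]
  ring

theorem rpow_mul (hu : 0 < u.leadingCoeff) (hv : 0 < v.leadingCoeff) (r : ℝ) :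
    rpow (u * v) r = rpow u r * rpow v r := by
  have hu0 := ne_zero_of_leadingCoeff_pos hu
  have hv0 := ne_zero_of_leadingCoeff_pos hv
  rw [rpow_eq, rpow_eq, rpow_eq, add_sub_cancel, add_sub_cancel, add_sub_cancel,
    order_mul hu0 hv0, smul_add, leadingCoeff_mul, Real.mul_rpow hu.le hv.le, ← single_mul_single,
    relRem_mul hu0 hv0, (heval_binomialSeries_mul_and_log (orderTop_relRem_pos hu0)
      (orderTop_relRem_pos hv0)).1 r]
  ring

theorem rpow_rpow (hu : 0 < u.leadingCoeff) (r s : ℝ) : rpow (rpow u r) s = rpow u (r * s) := by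
  rw [rpow_eq (rpow u r), rpow_eq u (r * s), order_rpow hu, leadingCoeff_rpow hu, relRem_rpow hu,
    add_sub_cancel, add_sub_cancel, (heval_binomialSeries_pow_and_log (orderTop_relRem_pos
      (ne_zero_of_leadingCoeff_pos hu)) r).1 s, Real.rpow_mul hu.le, smul_smul, mul_comm s r]

theorem rpow_neg (hu : 0 < u.leadingCoeff) (r : ℝ) : rpow u (-r) = (rpow u r)⁻¹ := by
  refine eq_inv_of_mul_eq_one_left ?_
  rw [← rpow_add hu, neg_add_cancel, rpow_zero]

theorem rpow_neg_one (hu : 0 < u.leadingCoeff) : rpow u (-1) = u⁻¹ := by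
  rw [rpow_neg hu, rpow_one (ne_zero_of_leadingCoeff_pos hu)]

theorem rpow_single (n : Exponent) {c : ℝ} (hc : c ≠ 0) (r : ℝ) :
    rpow (HahnSeries.single n c) r = HahnSeries.single (r • n) (c ^ r) := by
  have hz : heval (0 : Transseries) (binomialSeries ℝ r) = 1 := by
    rw [heval_apply, powerSeriesFamily_hsum_zero]; simp
  have := rpow_single_mul (n := n) (e := 0) hc (by simp) r
  rwa [add_zero, mul_one, hz, mul_one] at this

/-- The logarithm of a monomial, up to the sign. -/
def negLogMonomial (n : Exponent) : Transseries :=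
  (ofLex n).sum (fun j r => HahnSeries.single (ellExp (j + 1) (-1)) r)

theorem negLogMonomial_add (n k : Exponent) :
    negLogMonomial (n + k) = negLogMonomial n + negLogMonomial k := by
  unfold negLogMonomial
  rw [ofLex_add, Finsupp.sum_add_index'] <;> simp

theorem negLogMonomial_smul (r : ℝ) (n : Exponent) :
    negLogMonomial (r • n) = r • negLogMonomial n := by
  unfold negLogMonomial
  rw [ofLex_smul, Finsupp.sum_smul_index (by simp), Finsupp.smul_sum]
  refine Finsupp.sum_congr fun j _ => ?_
  ext p
  simp [coeff_single]

theorem negLogMonomial_ellExp (j : ℕ) (r : ℝ) :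
    negLogMonomial (ellExp j r) = HahnSeries.single (ellExp (j + 1) (-1)) r := by
  unfold negLogMonomial ellExp
  rw [ofLex_toLex, Finsupp.sum_single_index (by simp)]

theorem log_eq (u : Transseries) : log u = HahnSeries.C (Real.log u.leadingCoeff) -
    negLogMonomial u.order + heval (relRem u) (PowerSeries.log ℝ) := rfl

theorem log_mul (hu : 0 < u.leadingCoeff) (hv : 0 < v.leadingCoeff) :
    log (u * v) = log u + log v := by
  have hu0 := ne_zero_of_leadingCoeff_pos hu
  have hv0 := ne_zero_of_leadingCoeff_pos hv
  rw [log_eq, log_eq, log_eq, order_mul hu0 hv0, negLogMonomial_add, leadingCoeff_mul,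
    Real.log_mul hu.ne' hv.ne', map_add, relRem_mul hu0 hv0,
    (heval_binomialSeries_mul_and_log (orderTop_relRem_pos hu0) (orderTop_relRem_pos hv0)).2]
  ring

theorem log_rpow (hu : 0 < u.leadingCoeff) (r : ℝ) : log (rpow u r) = r • log u := by
  rw [log_eq, log_eq, order_rpow hu, leadingCoeff_rpow hu, relRem_rpow hu,
    negLogMonomial_smul, (heval_binomialSeries_pow_and_log (orderTop_relRem_pos
      (ne_zero_of_leadingCoeff_pos hu)) r).2, Real.log_rpow hu, smul_add, smul_sub,
    ← HahnSeries.C_mul_eq_smul (x := HahnSeries.C (Real.log u.leadingCoeff)), map_mul]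

theorem log_single (n : Exponent) {c : ℝ} (hc : c ≠ 0) :
    log (HahnSeries.single n c) = HahnSeries.C (Real.log c) - negLogMonomial n := by
  have hz : heval (0 : Transseries) (PowerSeries.log ℝ) = 0 := by
    rw [heval_apply, powerSeriesFamily_hsum_zero]; simp
  have h : HahnSeries.single n c = HahnSeries.single n c * (1 + 0) := by rw [add_zero, mul_one]
  rw [log_eq, leadingCoeff_of_single, order_single hc, h, relRem_single_mul hc (by simp), hz,
    add_zero]

end Laws

/-! ### Lexicographic order of exponents -/

section Exponents

theorem exponent_ext {n k : Exponent} (h : ∀ j, ofLex n j = ofLex k j) : n = k :=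
  ofLex.injective (Finsupp.ext h)

theorem ofLex_add_apply (n k : Exponent) (j : ℕ) : ofLex (n + k) j = ofLex n j + ofLex k j := rfl

theorem ofLex_smul_apply (r : ℝ) (n : Exponent) (j : ℕ) : ofLex (r • n) j = r * ofLex n j := rfl

theorem ofLex_zero_apply (j : ℕ) : ofLex (0 : Exponent) j = 0 := rfl

theorem ofLex_ellExp_apply (i : ℕ) (r : ℝ) (j : ℕ) :
    ofLex (ellExp i r) j = if i = j then r else 0 := Finsupp.single_apply

theorem ofLex_expo_apply (a b c : ℝ) (j : ℕ) :
    ofLex (expo a b c) j = (if 0 = j then a else 0) + (if 1 = j then b else 0) +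
      (if 2 = j then c else 0) := by
  simp only [expo, ofLex_add_apply, ofLex_ellExp_apply]

theorem exponent_lt_iff {n k : Exponent} :
    n < k ↔ ∃ i, (∀ j < i, ofLex n j = ofLex k j) ∧ ofLex n i < ofLex k i :=
  Finsupp.Lex.lt_iff

theorem ellExp_pos (j : ℕ) {r : ℝ} (hr : 0 < r) : 0 < ellExp j r := by
  refine exponent_lt_iff.2 ⟨j, fun i hi => ?_, ?_⟩
  · rw [ofLex_ellExp_apply, if_neg hi.ne', ofLex_zero_apply]
  · rwa [ofLex_ellExp_apply, if_pos rfl, ofLex_zero_apply]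

theorem ellExp_add_ellExp_succ_pos (j : ℕ) {r : ℝ} (hr : 0 < r) (s : ℝ) :
    0 < ellExp j r + ellExp (j + 1) s := by
  refine exponent_lt_iff.2 ⟨j, fun i hi => ?_, ?_⟩
  · rw [ofLex_add_apply, ofLex_ellExp_apply, ofLex_ellExp_apply, if_neg hi.ne',
      if_neg (by omega), ofLex_zero_apply, add_zero]
  · rwa [ofLex_add_apply, ofLex_ellExp_apply, ofLex_ellExp_apply, if_pos rfl,
      if_neg (by omega), ofLex_zero_apply, add_zero]

theorem ellExp_zero (j : ℕ) : ellExp j 0 = 0 := by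
  unfold ellExp; rw [Finsupp.single_zero, toLex_zero]

theorem ellExp_add (j : ℕ) (r s : ℝ) : ellExp j (r + s) = ellExp j r + ellExp j s := by
  unfold ellExp; rw [Finsupp.single_add, toLex_add]

theorem neg_ellExp (j : ℕ) (r : ℝ) : -ellExp j r = ellExp j (-r) := by
  unfold ellExp; rw [Finsupp.single_neg, toLex_neg]

theorem smul_ellExp (j : ℕ) (r s : ℝ) : r • ellExp j s = ellExp j (r * s) := by
  refine exponent_ext fun i => ?_
  rw [ofLex_smul_apply, ofLex_ellExp_apply, ofLex_ellExp_apply, mul_ite, mul_zero]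

end Exponents

/-! ### Leading terms and remainders of `ℓ_j ∘ h` -/

section LeadingTerms

/-- The `e` in `-log u = a * ℓ_{j+1}⁻¹ * (1 + e)`, where the leading monomial of `u` is
`ℓ_j ^ a * ℓ_{j+1} ^ b`. -/
def logRem (j : ℕ) (a b : ℝ) (u : Transseries) : Transseries :=
  HahnSeries.single (ellExp (j + 1) 1) (-a⁻¹ * Real.log u.leadingCoeff) +
    HahnSeries.single (ellExp (j + 1) 1 + ellExp (j + 2) (-1)) (a⁻¹ * b) -
    HahnSeries.single (ellExp (j + 1) 1) a⁻¹ * heval (relRem u) (PowerSeries.log ℝ)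

variable {j : ℕ} {a b : ℝ} {u : Transseries}

/-- The logarithm is `-log c + a ℓ_{j+1}⁻¹ + b ℓ_{j+2}⁻¹ - log (1 + ε)` up to sign, and its dominant
term `a ℓ_{j+1}⁻¹` is factored out. -/
theorem neg_log_eq (ha : 0 < a) (hu : u.order = ellExp j a + ellExp (j + 1) b) :
    -log u = HahnSeries.single (ellExp (j + 1) (-1)) a * (1 + logRem j a b u) := by
  rw [log_eq, hu, negLogMonomial_add, negLogMonomial_ellExp, negLogMonomial_ellExp, logRem,
    mul_add, mul_sub, mul_add, ← mul_assoc, single_mul_single, single_mul_single,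
    single_mul_single, ← neg_ellExp, neg_add_cancel, neg_add_cancel_left, mul_inv_cancel₀ ha.ne',
    single_zero_one, one_mul, mul_one, mul_inv_cancel_left₀ ha.ne', ← mul_assoc, mul_neg,
    mul_inv_cancel₀ ha.ne', neg_one_mul, neg_ellExp, single_neg]
  have : HahnSeries.single (0 : Exponent) (Real.log u.leadingCoeff) =
    HahnSeries.C (Real.log u.leadingCoeff) := rfl
  rw [this]
  ring

/-- The monomial `ℓ_{j+1} ℓ_{j+2}⁻¹` enters with coefficient `b / a`, so it is needed only if `b ≠
0`. For `j = 0` this is the origin of the generator `(0, 1, -1)` and of the distinction between `m =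
0` and `m ≠ 0`. -/
theorem logRem_mem_supportedIn {M : AddSubmonoid Exponent} (hu : relRem u ∈ supportedIn M)
    (h1 : ellExp (j + 1) 1 ∈ M) (h2 : b = 0 ∨ ellExp (j + 1) 1 + ellExp (j + 2) (-1) ∈ M) :
    logRem j a b u ∈ supportedIn M := by
  refine Subalgebra.sub_mem _ (Subalgebra.add_mem _ (single_mem_supportedIn h1 _) ?_)
    (Subalgebra.mul_mem _ (single_mem_supportedIn h1 _) (heval_mem_supportedIn hu _))
  rcases h2 with rfl | h2
  · rw [mul_zero, single_eq_zero]; exact Subalgebra.zero_mem _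
  · exact single_mem_supportedIn h2 _

theorem orderTop_logRem_pos (hu : u ≠ 0) : 0 < (logRem j a b u).orderTop := by
  have h1 : 0 < ellExp (j + 1) 1 := ellExp_pos _ one_pos
  have h2 : 0 < ellExp (j + 1) 1 + ellExp (j + 2) (-1) := ellExp_add_ellExp_succ_pos _ one_pos _
  have hs : ∀ {n : Exponent} (r : ℝ), 0 < n → 0 < (HahnSeries.single n r).orderTop := fun r hn =>
    (WithTop.coe_pos.2 hn).trans_le orderTop_single_le
  have h3 : 0 < (HahnSeries.single (ellExp (j + 1) 1) a⁻¹ *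
      heval (relRem u) (PowerSeries.log ℝ)).orderTop := by
    rw [orderTop_mul]
    exact (hs _ h1).trans_le (le_add_of_nonneg_right
      (orderTop_heval_pos (orderTop_relRem_pos hu) constantCoeff_log).le)
  exact (lt_min (lt_min (hs _ h1) (hs _ h2)) h3).trans_le
    ((min_le_min_right _ min_orderTop_le_orderTop_add).trans min_orderTop_le_orderTop_sub)

theorem inv_neg_log_eq (ha : 0 < a) (hu : u.order = ellExp j a + ellExp (j + 1) b) (hu0 : u ≠ 0) :
    (-log u)⁻¹ = HahnSeries.single (ellExp (j + 1) 1) a⁻¹ *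
      (1 + (heval (logRem j a b u) (binomialSeries ℝ (-1 : ℝ)) - 1)) := by
  have hpos := orderTop_logRem_pos (j := j) (a := a) (b := b) hu0
  rw [← rpow_neg_one (by rw [neg_log_eq ha hu, leadingCoeff_single_mul hpos]; exact ha),
    neg_log_eq ha hu, rpow_single_mul ha.ne' hpos, smul_ellExp, Real.rpow_neg_one, add_sub_cancel]
  norm_num

theorem leadingCoeff_inv_neg_log (ha : 0 < a) (hu : u.order = ellExp j a + ellExp (j + 1) b)
    (hu0 : u ≠ 0) : (-log u)⁻¹.leadingCoeff = a⁻¹ := by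
  rw [inv_neg_log_eq ha hu hu0, leadingCoeff_single_mul (orderTop_heval_sub_one_pos
    (orderTop_logRem_pos hu0) (binomialSeries_constantCoeff _))]

theorem order_inv_neg_log (ha : 0 < a) (hu : u.order = ellExp j a + ellExp (j + 1) b)
    (hu0 : u ≠ 0) : (-log u)⁻¹.order = ellExp (j + 1) 1 := by
  rw [inv_neg_log_eq ha hu hu0, order_single_mul (inv_ne_zero ha.ne') (orderTop_heval_sub_one_pos
    (orderTop_logRem_pos hu0) (binomialSeries_constantCoeff _))]

theorem relRem_inv_neg_log_mem_supportedIn {M : AddSubmonoid Exponent} (ha : 0 < a)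
    (hu : u.order = ellExp j a + ellExp (j + 1) b) (hu0 : u ≠ 0) (hM : relRem u ∈ supportedIn M)
    (h1 : ellExp (j + 1) 1 ∈ M) (h2 : b = 0 ∨ ellExp (j + 1) 1 + ellExp (j + 2) (-1) ∈ M) :
    relRem (-log u)⁻¹ ∈ supportedIn M := by
  rw [inv_neg_log_eq ha hu hu0, relRem_single_mul (inv_ne_zero ha.ne') (orderTop_heval_sub_one_pos
    (orderTop_logRem_pos hu0) (binomialSeries_constantCoeff _))]
  exact Subalgebra.sub_mem _ (heval_mem_supportedIn (logRem_mem_supportedIn hM h1 h2) _)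
    (Subalgebra.one_mem _)

/-- `h` has a positive leading coefficient and the leading monomial `x ^ a * ℓ ^ b`. -/
structure HasLeading (h : Transseries) (a b : ℝ) : Prop where
  leadingCoeff_pos : 0 < h.leadingCoeff
  order_eq : h.order = expo a b 0
  pos : 0 < a

variable {h : Transseries}

theorem expo_zero (a b : ℝ) : expo a b 0 = ellExp 0 a + ellExp 1 b := by
  rw [expo, ellExp_zero, add_zero]

theorem HasLeading.ne_zero (H : HasLeading h a b) : h ≠ 0 :=
  ne_zero_of_leadingCoeff_pos H.leadingCoeff_pos

theorem HasLeading.order_eq' (H : HasLeading h a b) :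
    (ellComp h 0).order = ellExp 0 a + ellExp (0 + 1) b := by
  rw [ellComp, H.order_eq, expo_zero]

theorem HasLeading.isPosInfinitesimal (H : HasLeading h a b) : IsPosInfinitesimal h :=
  ⟨H.leadingCoeff_pos, by rw [H.order_eq, expo_zero]; exact ellExp_add_ellExp_succ_pos 0 H.pos b⟩

theorem HasLeading.leadingCoeff_ellComp_one (H : HasLeading h a b) :
    (ellComp h 1).leadingCoeff = a⁻¹ :=
  leadingCoeff_inv_neg_log H.pos H.order_eq' H.ne_zero

theorem HasLeading.ellComp_succ (H : HasLeading h a b) (j : ℕ) :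
    0 < (ellComp h (j + 1)).leadingCoeff ∧ (ellComp h (j + 1)).order = ellExp (j + 1) 1 := by
  induction j with
  | zero =>
    refine ⟨?_, order_inv_neg_log H.pos H.order_eq' H.ne_zero⟩
    rw [zero_add, H.leadingCoeff_ellComp_one]
    exact inv_pos.2 H.pos
  | succ j ih =>
    have h1 : (ellComp h (j + 1)).order = ellExp (j + 1) 1 + ellExp (j + 1 + 1) 0 := by
      rw [ih.2, ellExp_zero, add_zero]
    have h0 := ne_zero_of_leadingCoeff_pos ih.1
    rw [ellComp]
    exact ⟨by rw [leadingCoeff_inv_neg_log one_pos h1 h0]; norm_num,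
      order_inv_neg_log one_pos h1 h0⟩

theorem HasLeading.leadingCoeff_ellComp_succ_succ (H : HasLeading h a b) (j : ℕ) :
    (ellComp h (j + 2)).leadingCoeff = 1 := by
  have ih := H.ellComp_succ j
  have h1 : (ellComp h (j + 1)).order = ellExp (j + 1) 1 + ellExp (j + 1 + 1) 0 := by
    rw [ih.2, ellExp_zero, add_zero]
  rw [ellComp, leadingCoeff_inv_neg_log one_pos h1 (ne_zero_of_leadingCoeff_pos ih.1), inv_one]

theorem HasLeading.leadingCoeff_ellComp_pos (H : HasLeading h a b) (j : ℕ) :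
    0 < (ellComp h j).leadingCoeff := by
  cases j with
  | zero => exact H.leadingCoeff_pos
  | succ j => exact (H.ellComp_succ j).1

theorem HasLeading.relRem_ellComp_one_mem (H : HasLeading h a b) {M : AddSubmonoid Exponent}
    (hM : relRem h ∈ supportedIn M) (h1 : ellExp 1 1 ∈ M)
    (h2 : b = 0 ∨ ellExp 1 1 + ellExp 2 (-1) ∈ M) : relRem (ellComp h 1) ∈ supportedIn M :=
  relRem_inv_neg_log_mem_supportedIn H.pos H.order_eq' H.ne_zero hM h1 h2

/-- The leading monomial of `ℓ_{j+1} ∘ h` is `ℓ_{j+1}` alone, so this is the case `b = 0`, where no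
quotient of iterated logarithms is required. -/
theorem HasLeading.relRem_ellComp_succ_succ_mem (H : HasLeading h a b) {M : AddSubmonoid Exponent}
    {j : ℕ} (hM : relRem (ellComp h (j + 1)) ∈ supportedIn M) (h1 : ellExp (j + 2) 1 ∈ M) :
    relRem (ellComp h (j + 2)) ∈ supportedIn M := by
  have ih := H.ellComp_succ j
  have hj : (ellComp h (j + 1)).order = ellExp (j + 1) 1 + ellExp (j + 1 + 1) 0 := by
    rw [ih.2, ellExp_zero, add_zero]
  exact relRem_inv_neg_log_mem_supportedIn one_pos hj (ne_zero_of_leadingCoeff_pos ih.1) hM h1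
    (Or.inl rfl)

end LeadingTerms

/-! ### Strongly linear substitutions and triangular systems -/

section Substitution

variable {Γ : Type*} [AddCommGroup Γ] [LinearOrder Γ] [IsOrderedAddMonoid Γ]

/-- A multiplicative assignment of series to monomials, with controlled supports, that extends
to a strongly linear ring endomorphism. -/
structure MonomialSubst (Γ : Type*) [AddCommGroup Γ] [LinearOrder Γ] [IsOrderedAddMonoid Γ] where
  /-- The image of a monomial. -/
  toFun : Γ → HahnSeries Γ ℝ
  /-- The leading exponent of the image of a monomial. -/
  lead : Γ → Γ
  /-- The exponents of the images relative to the leading ones. -/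
  rel : AddSubmonoid Γ
  map_zero : toFun 0 = 1
  map_add : ∀ n k, toFun (n + k) = toFun n * toFun k
  lead_zero : lead 0 = 0
  lead_strictMono : StrictMono lead
  rel_isPWO : (rel : Set Γ).IsPWO
  rel_nonneg : ∀ t ∈ rel, 0 ≤ t
  support_subset : ∀ n, ∀ p ∈ (toFun n).support, ∃ t ∈ rel, lead n + t = p

/-- The family of the terms of a series. -/
def termFamily {Γ : Type*} [LinearOrder Γ] (f : HahnSeries Γ ℝ) : SummableFamily Γ ℝ Γ where
  toFun n := HahnSeries.single n (f.coeff n)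
  isPWO_iUnion_support' := f.isPWO_support.mono (Set.iUnion_subset fun n p hp => by
    rw [eq_of_mem_support_single hp]
    intro h0
    rw [h0, single_eq_zero] at hp
    simp at hp)
  finite_co_support' p := (Set.finite_singleton p).subset fun n hn =>
    (eq_of_mem_support_single (show p ∈ (HahnSeries.single n (f.coeff n)).support from hn)).symm

theorem termFamily_apply {Γ : Type*} [LinearOrder Γ] (f : HahnSeries Γ ℝ) (n : Γ) :
    termFamily f n = HahnSeries.single n (f.coeff n) := rfl

theorem hsum_termFamily {Γ : Type*} [LinearOrder Γ] (f : HahnSeries Γ ℝ) :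
    (termFamily f).hsum = f := by
  ext p
  rw [coeff_hsum, finsum_eq_single _ p fun n hn => by
    rw [termFamily_apply, coeff_single_of_ne hn.symm], termFamily_apply, coeff_single_same]

namespace MonomialSubst

variable (S : MonomialSubst Γ)

/-- A contributing `n` writes `p` as `lead n + t` with summands in two partially well-ordered sets;
there are finitely many such decompositions, and `lead` is injective. -/
theorem finite_contributing {W : Set Γ} (hW : W.IsPWO) (p : Γ) :
    {n ∈ W | (S.toFun n).coeff p ≠ 0}.Finite := by
  have h := Set.AddAntidiagonal.finite_of_isPWO
    (hW.image_of_monotone S.lead_strictMono.monotone) S.rel_isPWO p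
  refine Set.Finite.of_finite_image ((h.image Prod.fst).subset ?_)
    (S.lead_strictMono.injective.injOn)
  rintro _ ⟨n, ⟨hn, hp⟩, rfl⟩
  obtain ⟨t, ht, rfl⟩ := S.support_subset n p hp
  exact ⟨(S.lead n, t), ⟨⟨n, hn, rfl⟩, ht, rfl⟩, rfl⟩

theorem isPWO_lead_add {W : Set Γ} (hW : W.IsPWO) :
    {p | ∃ n ∈ W, ∃ t ∈ S.rel, S.lead n + t = p}.IsPWO := by
  refine ((hW.image_of_monotone S.lead_strictMono.monotone).add S.rel_isPWO).mono ?_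
  rintro _ ⟨n, hn, t, ht, rfl⟩
  exact Set.add_mem_add ⟨n, hn, rfl⟩ ht

/-- The images of the terms of a series. -/
def family (f : HahnSeries Γ ℝ) : SummableFamily Γ ℝ Γ where
  toFun n := f.coeff n • S.toFun n
  isPWO_iUnion_support' := (S.isPWO_lead_add f.isPWO_support).mono
    (Set.iUnion_subset fun n p hp => by
      rw [HahnSeries.mem_support, HahnSeries.coeff_smul, smul_eq_mul] at hp
      exact ⟨n, left_ne_zero_of_mul hp, S.support_subset n p (right_ne_zero_of_mul hp)⟩)
  finite_co_support' p := (S.finite_contributing f.isPWO_support p).subset fun n hn => by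
    rw [Set.mem_ofPred_eq, HahnSeries.coeff_smul, smul_eq_mul] at hn
    exact ⟨left_ne_zero_of_mul hn, right_ne_zero_of_mul hn⟩

theorem family_apply (f : HahnSeries Γ ℝ) (n : Γ) : S.family f n = f.coeff n • S.toFun n := rfl

/-- The strongly linear extension. -/
def subst (f : HahnSeries Γ ℝ) : HahnSeries Γ ℝ := (S.family f).hsum

theorem coeff_subst (f : HahnSeries Γ ℝ) (p : Γ) :
    (S.subst f).coeff p = ∑ᶠ n, f.coeff n * (S.toFun n).coeff p := by
  rw [subst, coeff_hsum]; rfl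

theorem coeff_subst_eq_sum {f : HahnSeries Γ ℝ} {p : Γ} {N : Finset Γ}
    (hN : ∀ n ∈ f.support, (S.toFun n).coeff p ≠ 0 → n ∈ N) :
    (S.subst f).coeff p = ∑ n ∈ N, f.coeff n * (S.toFun n).coeff p := by
  rw [coeff_subst]
  exact finsum_eq_sum_of_support_subset _ fun n hn =>
    hN n (left_ne_zero_of_mul hn) (right_ne_zero_of_mul hn)

theorem support_subst {f : HahnSeries Γ ℝ} {p : Γ} (hp : p ∈ (S.subst f).support) :
    ∃ n ∈ f.support, ∃ t ∈ S.rel, S.lead n + t = p := by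
  obtain ⟨n, hn⟩ := Set.mem_iUnion.1 (support_hsum_subset hp)
  rw [HahnSeries.mem_support, family_apply, HahnSeries.coeff_smul, smul_eq_mul] at hn
  exact ⟨n, left_ne_zero_of_mul hn, S.support_subset n p (right_ne_zero_of_mul hn)⟩

theorem subst_single (n : Γ) (c : ℝ) : S.subst (HahnSeries.single n c) = c • S.toFun n := by
  ext p
  rw [coeff_subst, finsum_eq_single _ n fun k hk => by
    rw [coeff_single_of_ne hk, zero_mul], coeff_single_same]
  rfl

theorem subst_add (f g : HahnSeries Γ ℝ) : S.subst (f + g) = S.subst f + S.subst g := by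
  rw [subst, subst, subst, ← hsum_add]
  congr 1
  ext n p
  rw [SummableFamily.add_apply, HahnSeries.coeff_add, family_apply, family_apply, family_apply,
    HahnSeries.coeff_smul, HahnSeries.coeff_smul, HahnSeries.coeff_smul, HahnSeries.coeff_add,
    add_smul]

theorem subst_smul (c : ℝ) (f : HahnSeries Γ ℝ) : S.subst (c • f) = c • S.subst f := by
  ext p
  have hN : ∀ n ∈ f.support, (S.toFun n).coeff p ≠ 0 →
      n ∈ (S.finite_contributing f.isPWO_support p).toFinset := fun n hn hp =>
    (Set.Finite.mem_toFinset _).2 ⟨hn, hp⟩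
  rw [S.coeff_subst_eq_sum fun n hn => hN n (support_smul_subset c f hn), HahnSeries.coeff_smul,
    S.coeff_subst_eq_sum hN, Finset.smul_sum]
  exact Finset.sum_congr rfl fun n _ => mul_assoc c _ _

variable {ι : Type*}

/-- Only finitely many exponents of the union of the supports contribute at `p`, and each of them
occurs in finitely many members of the family. The double sum is therefore finite and may be
interchanged. -/
theorem coeff_hsum_subst_aux (s : SummableFamily Γ ℝ ι) (p : Γ) : ∃ I : Finset ι,
    (∀ i, (S.subst (s i)).coeff p ≠ 0 → i ∈ I) ∧
    (S.subst s.hsum).coeff p = ∑ i ∈ I, (S.subst (s i)).coeff p := by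
  set N := (S.finite_contributing s.isPWO_iUnion_support p).toFinset with hN
  have hmem : ∀ i, ∀ n ∈ (s i).support, (S.toFun n).coeff p ≠ 0 → n ∈ N := fun i n hn hp =>
    (Set.Finite.mem_toFinset _).2 ⟨Set.mem_iUnion.2 ⟨i, hn⟩, hp⟩
  classical
  set I := N.biUnion fun n => (s.coeff n).support with hI
  have hmemI : ∀ n ∈ N, ∀ i, (s i).coeff n ≠ 0 → i ∈ I := fun n hn i hi =>
    Finset.mem_biUnion.2 ⟨n, hn, Finsupp.mem_support_iff.2 hi⟩
  refine ⟨I, fun i hi => ?_, ?_⟩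
  · rw [S.coeff_subst_eq_sum (hmem i)] at hi
    obtain ⟨n, hn, h⟩ := Finset.exists_ne_zero_of_sum_ne_zero hi
    exact hmemI n hn i (left_ne_zero_of_mul h)
  · rw [S.coeff_subst_eq_sum (N := N) fun n hn hp => (Set.Finite.mem_toFinset _).2
      ⟨support_hsum_subset hn, hp⟩, Finset.sum_congr rfl fun i _ => S.coeff_subst_eq_sum (hmem i),
      Finset.sum_comm]
    refine Finset.sum_congr rfl fun n hn => ?_
    rw [coeff_hsum_eq_sum_of_subset (t := I) fun i hi => hmemI n hn i hi, Finset.sum_mul]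

/-- The images of the members of a summable family. -/
def mapFamily (s : SummableFamily Γ ℝ ι) : SummableFamily Γ ℝ ι where
  toFun i := S.subst (s i)
  isPWO_iUnion_support' := (S.isPWO_lead_add s.isPWO_iUnion_support).mono
    (Set.iUnion_subset fun i p hp => by
      obtain ⟨n, hn, h⟩ := S.support_subst hp
      exact ⟨n, Set.mem_iUnion.2 ⟨i, hn⟩, h⟩)
  finite_co_support' p := by
    obtain ⟨I, hI, -⟩ := S.coeff_hsum_subst_aux s p
    exact I.finite_toSet.subset fun i hi => hI i hi

theorem mapFamily_apply (s : SummableFamily Γ ℝ ι) (i : ι) : S.mapFamily s i = S.subst (s i) := rfl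

theorem subst_hsum (s : SummableFamily Γ ℝ ι) : S.subst s.hsum = (S.mapFamily s).hsum := by
  ext p
  obtain ⟨I, hI, h⟩ := S.coeff_hsum_subst_aux s p
  have hsub : {i | (S.mapFamily s i).coeff p ≠ 0} ⊆ I := fun i hi => hI i hi
  rw [h, coeff_hsum_eq_sum_of_subset hsub]
  rfl

theorem subst_mul (f g : HahnSeries Γ ℝ) : S.subst (f * g) = S.subst f * S.subst g := by
  -- Both factors are expanded into terms; on pairs of terms the claim is multiplicativity on
  -- monomials.
  conv_lhs => rw [← hsum_termFamily f, ← hsum_termFamily g, ← hsum_mul, subst_hsum]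
  rw [subst, subst, ← hsum_mul]
  congr 1
  ext1 ⟨n, k⟩
  rw [mapFamily_apply, mul_toFun, mul_toFun, termFamily_apply, termFamily_apply, single_mul_single,
    subst_single, map_add, family_apply, family_apply, smul_mul_smul_comm]

theorem subst_one : S.subst 1 = 1 := by
  rw [← single_zero_one, subst_single, map_zero, one_smul, single_zero_one]

/-- The substitution as a ring homomorphism. -/
def hom : HahnSeries Γ ℝ →+* HahnSeries Γ ℝ where
  toFun := S.subst
  map_one' := S.subst_one
  map_mul' := S.subst_mul
  map_zero' := by
    ext p
    rw [coeff_subst]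
    simp
  map_add' := S.subst_add

theorem hom_apply (f : HahnSeries Γ ℝ) : S.hom f = S.subst f := rfl

theorem hom_smul (c : ℝ) (f : HahnSeries Γ ℝ) : S.hom (c • f) = c • S.hom f := S.subst_smul c f

theorem hom_single (n : Γ) (c : ℝ) : S.hom (HahnSeries.single n c) = c • S.toFun n :=
  S.subst_single n c

theorem hom_C (c : ℝ) : S.hom (HahnSeries.C c) = HahnSeries.C c := by
  have := S.hom_single 0 c
  rwa [map_zero, ← HahnSeries.C_mul_eq_smul, mul_one] at this

theorem orderTop_hom_pos {e : HahnSeries Γ ℝ} (he : 0 < e.orderTop) : 0 < (S.hom e).orderTop := by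
  refine orderTop_pos_iff.2 fun p hp => ?_
  obtain ⟨n, hn, t, ht, rfl⟩ := S.support_subst hp
  have h : S.lead 0 < S.lead n := S.lead_strictMono (pos_of_mem_support he hn)
  rw [S.lead_zero] at h
  exact add_pos_of_pos_of_nonneg h (S.rel_nonneg t ht)

theorem hom_heval {e : HahnSeries Γ ℝ} (he : 0 < e.orderTop) (f : PowerSeries ℝ) :
    S.hom (heval e f) = heval (S.hom e) f := by
  rw [heval_apply, heval_apply, hom_apply, subst_hsum]
  congr 1
  ext1 i
  rw [mapFamily_apply, powerSeriesFamily_of_orderTop_pos he,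
    powerSeriesFamily_of_orderTop_pos (S.orderTop_hom_pos he), ← hom_apply, hom_smul, map_pow]

end MonomialSubst

/-- A triangular linear system indexed by a well-ordered monoid of exponents is solvable. -/
theorem exists_triangular_solution {M : AddSubmonoid Γ} (hM : (M : Set Γ).IsPWO)
    (hM0 : ∀ t ∈ M, 0 ≤ t) {F : Γ → HahnSeries Γ ℝ}
    (hF : ∀ q ∈ M, ∀ p ∈ (F q).support, ∃ t ∈ M, q + t = p)
    (hF' : ∀ q ∈ M, (F q).coeff q ≠ 0) :
    ∃ b : Γ → ℝ, (∀ q, b q ≠ 0 → q ∈ M) ∧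
      ∀ p, ∑ᶠ q, b q * (F q).coeff p = (1 : HahnSeries Γ ℝ).coeff p := by
  classical
  have hwf : WellFounded ((· < ·) : M → M → Prop) := hM.isWF
  -- The `q ∈ M` with `p - q ∈ M`: these are finitely many, and they include every unknown that
  -- occurs in the equation at `p`.
  let T : Γ → Finset Γ := fun p =>
    (Set.AddAntidiagonal.finite_of_isPWO hM hM p).toFinset.image Prod.fst
  have hT : ∀ q ∈ M, ∀ p, (F q).coeff p ≠ 0 → q ∈ T p := fun q hq p hp => by
    obtain ⟨t, ht, rfl⟩ := hF q hq p hp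
    exact Finset.mem_image.2 ⟨(q, t), (Set.Finite.mem_toFinset _).2 ⟨hq, ht, rfl⟩, rfl⟩
  have hT' : ∀ p, ∀ q ∈ T p, q ∈ M ∧ p ∈ M ∧ q ≤ p := fun p q hq => by
    obtain ⟨⟨q', t⟩, h, rfl⟩ := Finset.mem_image.1 hq
    obtain ⟨hqM, ht, rfl⟩ := (Set.Finite.mem_toFinset _).1 h
    exact ⟨hqM, M.add_mem hqM ht, le_add_of_nonneg_right (hM0 t ht)⟩
  -- The equation at `p` is solved for `b p`, the unknowns below `p` being known, by division by the
  -- diagonal coefficient. The `if` only supplies the proof of `q < p` for the recursion and always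
  -- holds on `(T p).erase p`.
  let step : (p : M) → ((q : M) → q < p → ℝ) → ℝ := fun p b =>
    ((1 : HahnSeries Γ ℝ).coeff p - ∑ q ∈ (T p).erase p,
      if h : ∃ hq : q ∈ M, (⟨q, hq⟩ : M) < p then b ⟨q, h.1⟩ h.2 * (F q).coeff p else 0) /
      (F p).coeff p
  let b₀ : M → ℝ := hwf.fix step
  let b : Γ → ℝ := fun q => if h : q ∈ M then b₀ ⟨q, h⟩ else 0
  have hb : ∀ q, b q ≠ 0 → q ∈ M := fun q hq => by
    by_contra h
    exact hq (dif_neg h)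
  have hrec : ∀ p ∈ M, b p * (F p).coeff p = (1 : HahnSeries Γ ℝ).coeff p -
      ∑ q ∈ (T p).erase p, b q * (F q).coeff p := fun p hp => by
    have h1 : b p = step ⟨p, hp⟩ fun q _ => b₀ q := by
      rw [← hwf.fix_eq step ⟨p, hp⟩]
      exact dif_pos hp
    rw [h1, div_mul_cancel₀ _ (hF' p hp)]
    congr 1
    refine Finset.sum_congr rfl fun q hq => ?_
    obtain ⟨hqp, hqT⟩ := Finset.mem_erase.1 hq
    obtain ⟨hqM, -, hle⟩ := hT' p q hqT
    rw [dif_pos ⟨hqM, Subtype.mk_lt_mk.2 (lt_of_le_of_ne hle hqp)⟩]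
    congr 1
    simp only [b, dif_pos hqM]
  refine ⟨b, hb, fun p => ?_⟩
  rw [finsum_eq_sum_of_support_subset (s := T p) _ fun q hq =>
    hT q (hb q (left_ne_zero_of_mul hq)) p (right_ne_zero_of_mul hq)]
  by_cases hp : p ∈ M
  · rw [← Finset.add_sum_erase _ _ (hT p hp p (hF' p hp)), hrec p hp, sub_add_cancel]
  -- Off `M` the equation is `0 = 0`, since `M` contains `0`.
  · have h1 : T p = ∅ := Finset.eq_empty_of_forall_notMem fun q hq => hp (hT' p q hq).2.1
    rw [h1, Finset.sum_empty, HahnSeries.coeff_one, if_neg]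
    rintro rfl
    exact hp M.zero_mem

end Substitution

/-! ### Composition as a ring endomorphism; left inverses are two-sided -/

section Composition

/-- The part of a monomial in which only the `ℓ_j` with `3 ≤ j` occur. -/
def tailExp (n : Exponent) : Exponent := toLex ((ofLex n).filter (3 ≤ ·))

theorem ofLex_tailExp_apply (n : Exponent) (j : ℕ) :
    ofLex (tailExp n) j = if 3 ≤ j then ofLex n j else 0 := Finsupp.filter_apply _ _ _

theorem tailExp_add (n k : Exponent) : tailExp (n + k) = tailExp n + tailExp k := by
  refine exponent_ext fun j => ?_
  simp only [ofLex_add_apply, ofLex_tailExp_apply]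
  split_ifs <;> simp

theorem tailExp_zero : tailExp 0 = 0 := by
  refine exponent_ext fun j => ?_
  simp [ofLex_tailExp_apply]

theorem tailExp_smul (r : ℝ) (n : Exponent) : tailExp (r • n) = r • tailExp n := by
  refine exponent_ext fun j => ?_
  simp only [ofLex_smul_apply, ofLex_tailExp_apply, mul_ite, mul_zero]

theorem tailExp_eq_zero {n : Exponent} (hn : ∀ j, 2 < j → ofLex n j = 0) : tailExp n = 0 := by
  refine exponent_ext fun j => ?_
  rw [ofLex_tailExp_apply, ofLex_zero_apply]
  split_ifs with h
  · exact hn j h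
  · rfl

theorem eq_ellExp_add_ellExp {n : Exponent} (hn : ∀ j, 1 < j → ofLex n j = 0) :
    n = ellExp 0 (ofLex n 0) + ellExp 1 (ofLex n 1) := by
  refine exponent_ext fun j => ?_
  rw [ofLex_add_apply, ofLex_ellExp_apply, ofLex_ellExp_apply]
  rcases j with - | - | j
  · simp
  · simp
  · rw [hn _ (by omega)]; simp

/-- The composition of a monomial with `h`, except that `ℓ_j` for `3 ≤ j` is kept. -/
def truncComp (h : Transseries) (n : Exponent) : Transseries :=
  rpow (ellComp h 0) (ofLex n 0) * rpow (ellComp h 1) (ofLex n 1) * rpow (ellComp h 2) (ofLex n 2) *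
    HahnSeries.single (tailExp n) 1

theorem monomialComp_eq_prod (h : Transseries) {n : Exponent} {s : Finset ℕ}
    (hn : ∀ j ∉ s, ofLex n j = 0) :
    monomialComp h n = ∏ j ∈ s, rpow (ellComp h j) (ofLex n j) := by
  refine Finsupp.prod_of_support_subset _ (fun j hj => ?_) _ fun j _ => rpow_zero _
  by_contra hjs
  exact Finsupp.mem_support_iff.1 hj (hn j hjs)

theorem truncComp_eq_monomialComp (h : Transseries) {n : Exponent}
    (hn : ∀ j, 2 < j → ofLex n j = 0) : truncComp h n = monomialComp h n := by
  rw [truncComp, tailExp_eq_zero hn, single_zero_one, mul_one,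
    monomialComp_eq_prod h (s := Finset.range 3) fun j hj =>
      hn j (by rw [Finset.mem_range] at hj; omega)]
  simp [Finset.prod_range_succ]

variable {h : Transseries} {a b : ℝ}

/-- The leading exponent of `truncComp h n`, where `h` has the leading exponent `(a, b)`. -/
def leadExp (a b : ℝ) (n : Exponent) : Exponent :=
  n + expo ((a - 1) * ofLex n 0) (b * ofLex n 0) 0

theorem ofLex_leadExp_zero (a b : ℝ) (n : Exponent) :
    ofLex (leadExp a b n) 0 = a * ofLex n 0 := by
  rw [leadExp, ofLex_add_apply, ofLex_expo_apply]; simp; ring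

theorem ofLex_leadExp_one (a b : ℝ) (n : Exponent) :
    ofLex (leadExp a b n) 1 = b * ofLex n 0 + ofLex n 1 := by
  rw [leadExp, ofLex_add_apply, ofLex_expo_apply]; simp; ring

theorem ofLex_leadExp_of_two_le (a b : ℝ) (n : Exponent) {j : ℕ} (hj : 2 ≤ j) :
    ofLex (leadExp a b n) j = ofLex n j := by
  rw [leadExp, ofLex_add_apply, ofLex_expo_apply, if_neg (by omega), if_neg (by omega)]; simp

theorem leadExp_strictMono (ha : 0 < a) (b : ℝ) : StrictMono (leadExp a b) := by
  intro n k hnk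
  obtain ⟨i, hi, hlt⟩ := exponent_lt_iff.1 hnk
  refine exponent_lt_iff.2 ⟨i, fun j hj => ?_, ?_⟩
  · rcases j with - | - | j
    · rw [ofLex_leadExp_zero, ofLex_leadExp_zero, hi 0 hj]
    · rw [zero_add, ofLex_leadExp_one, ofLex_leadExp_one, hi 0 (by omega), hi 1 hj]
    · rw [ofLex_leadExp_of_two_le _ _ _ (by omega), ofLex_leadExp_of_two_le _ _ _ (by omega),
        hi _ hj]
  · rcases i with - | - | i
    · rw [ofLex_leadExp_zero, ofLex_leadExp_zero]
      exact mul_lt_mul_of_pos_left hlt ha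
    · rw [zero_add, ofLex_leadExp_one, ofLex_leadExp_one, hi 0 (by omega)]
      exact (add_lt_add_iff_left _).2 hlt
    · rwa [ofLex_leadExp_of_two_le _ _ _ (by omega), ofLex_leadExp_of_two_le _ _ _ (by omega)]

theorem leadExp_zero (a b : ℝ) : leadExp a b 0 = 0 := by
  refine exponent_ext fun j => ?_
  rcases j with - | - | j
  · rw [ofLex_leadExp_zero, ofLex_zero_apply, mul_zero]
  · rw [zero_add, ofLex_leadExp_one, ofLex_zero_apply, ofLex_zero_apply, mul_zero, add_zero]
  · rw [ofLex_leadExp_of_two_le _ _ _ (by omega)]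

namespace HasLeading

theorem leadingCoeff_truncComp_pos (H : HasLeading h a b) (n : Exponent) :
    0 < (truncComp h n).leadingCoeff := by
  have := fun j r => leadingCoeff_rpow_pos (H.leadingCoeff_ellComp_pos j) r
  refine leadingCoeff_mul_pos (leadingCoeff_mul_pos (leadingCoeff_mul_pos (this _ _) (this _ _))
    (this _ _)) ?_
  rw [leadingCoeff_of_single]; exact one_pos

theorem truncComp_eq (H : HasLeading h a b) (n : Exponent) : truncComp h n =
    HahnSeries.single (leadExp a b n) (h.leadingCoeff ^ ofLex n 0 * a⁻¹ ^ ofLex n 1) *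
      (heval (relRem h) (binomialSeries ℝ (ofLex n 0)) *
        heval (relRem (ellComp h 1)) (binomialSeries ℝ (ofLex n 1)) *
        heval (relRem (ellComp h 2)) (binomialSeries ℝ (ofLex n 2))) := by
  have hl : leadExp a b n = ofLex n 0 • h.order + ofLex n 1 • (ellComp h 1).order +
      ofLex n 2 • (ellComp h 2).order + tailExp n := by
    rw [H.order_eq, (H.ellComp_succ 0).2, (H.ellComp_succ 1).2]
    refine exponent_ext fun j => ?_
    simp only [ofLex_add_apply, ofLex_smul_apply, ofLex_expo_apply, ofLex_ellExp_apply,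
      ofLex_tailExp_apply]
    rcases j with - | - | - | j
    · rw [ofLex_leadExp_zero]; simp; ring
    · rw [zero_add, ofLex_leadExp_one]; simp; ring
    · rw [ofLex_leadExp_of_two_le _ _ _ (by omega)]; simp
    · rw [ofLex_leadExp_of_two_le _ _ _ (by omega)]; simp
  rw [truncComp, rpow_eq, rpow_eq, rpow_eq, add_sub_cancel, add_sub_cancel, add_sub_cancel, hl,
    H.leadingCoeff_ellComp_one, H.leadingCoeff_ellComp_succ_succ 0, Real.one_rpow,
    ← mul_one (h.leadingCoeff ^ _ * _), ← mul_one (h.leadingCoeff ^ _ * _ * 1),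
    ← single_mul_single, ← single_mul_single, ← single_mul_single]
  simp only [ellComp]
  ring

theorem coeff_truncComp_leadExp (H : HasLeading h a b) (n : Exponent) :
    (truncComp h n).coeff (leadExp a b n) =
    h.leadingCoeff ^ ofLex n 0 * a⁻¹ ^ ofLex n 1 := by
  have hw : ∀ (j : ℕ) (r : ℝ), (heval (relRem (ellComp h j)) (binomialSeries ℝ r)).orderTop = 0 ∧
      (heval (relRem (ellComp h j)) (binomialSeries ℝ r)).leadingCoeff = 1 := fun j r =>
    (orderTop_self_sub_one_pos_iff _).1 (orderTop_binomial_pos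
      (ne_zero_of_leadingCoeff_pos (H.leadingCoeff_ellComp_pos j)) r)
  have hc : h.leadingCoeff ^ ofLex n 0 * a⁻¹ ^ ofLex n 1 ≠ 0 :=
    (mul_pos (Real.rpow_pos_of_pos H.leadingCoeff_pos _)
      (Real.rpow_pos_of_pos (inv_pos.2 H.pos) _)).ne'
  have h0 := hw 0 (ofLex n 0)
  rw [ellComp] at h0
  have ht : (truncComp h n).orderTop = leadExp a b n := by
    rw [H.truncComp_eq, orderTop_mul, orderTop_mul, orderTop_mul, h0.1, (hw 1 _).1, (hw 2 _).1,
      orderTop_single hc, add_zero, add_zero, add_zero]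
  have hl : (truncComp h n).leadingCoeff = h.leadingCoeff ^ ofLex n 0 * a⁻¹ ^ ofLex n 1 := by
    rw [H.truncComp_eq, leadingCoeff_mul, leadingCoeff_mul, leadingCoeff_mul, h0.2, (hw 1 _).2,
      (hw 2 _).2, leadingCoeff_of_single, mul_one, mul_one, mul_one]
  rw [← hl, HahnSeries.leadingCoeff, ht]
  rfl

/-- The remainder of `ℓ₂ ∘ h` matters only for monomials containing `ℓ₂`. For `m = 0` this allows a
monoid `M` without `ℓ₂`. -/
theorem support_truncComp (H : HasLeading h a b) {M : AddSubmonoid Exponent}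
    (h0 : relRem h ∈ supportedIn M)
    (h1 : relRem (ellComp h 1) ∈ supportedIn M) {n : Exponent}
    (h2 : ofLex n 2 = 0 ∨ relRem (ellComp h 2) ∈ supportedIn M) {p : Exponent}
    (hp : p ∈ (truncComp h n).support) : ∃ t ∈ M, leadExp a b n + t = p := by
  rw [H.truncComp_eq] at hp
  have hw : heval (relRem h) (binomialSeries ℝ (ofLex n 0)) *
        heval (relRem (ellComp h 1)) (binomialSeries ℝ (ofLex n 1)) *
        heval (relRem (ellComp h 2)) (binomialSeries ℝ (ofLex n 2)) ∈ supportedIn M := by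
    refine Subalgebra.mul_mem _ (Subalgebra.mul_mem _ (heval_mem_supportedIn h0 _)
      (heval_mem_supportedIn h1 _)) ?_
    rcases h2 with h2 | h2
    · rw [h2, binomialSeries_zero, map_one]; exact Subalgebra.one_mem _
    · exact heval_mem_supportedIn h2 _
  obtain ⟨q, hq, t, ht, rfl⟩ := support_mul_subset hp
  rw [eq_of_mem_support_single hq]
  exact ⟨t, hw ht, rfl⟩

theorem isPWO_closure_relRem (H : HasLeading h a b) : (AddSubmonoid.closure ((relRem h).support ∪
    ((relRem (ellComp h 1)).support ∪ (relRem (ellComp h 2)).support)) : Set Exponent).IsPWO ∧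
    ∀ t ∈ AddSubmonoid.closure ((relRem h).support ∪
    ((relRem (ellComp h 1)).support ∪ (relRem (ellComp h 2)).support)), 0 ≤ t := by
  have hpos : ∀ j, ∀ t ∈ (relRem (ellComp h j)).support, 0 ≤ t := fun j t ht =>
    (pos_of_mem_support (orderTop_relRem_pos
      (ne_zero_of_leadingCoeff_pos (H.leadingCoeff_ellComp_pos j))) ht).le
  have hgen : ∀ t ∈ (relRem h).support ∪
      ((relRem (ellComp h 1)).support ∪ (relRem (ellComp h 2)).support), 0 ≤ t := by
    rintro t (ht | ht | ht)
    exacts [hpos 0 t ht, hpos 1 t ht, hpos 2 t ht]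
  refine ⟨Set.IsPWO.addSubmonoid_closure hgen ((isPWO_support _).union
    ((isPWO_support _).union (isPWO_support _))), fun t ht => ?_⟩
  exact (AddSubmonoid.closure_le (S := AddSubmonoid.nonneg Exponent)).2 hgen ht

/-- Composition with `h`, as far as monomials in `x`, `ℓ` and `ℓ₂` are concerned. -/
def compSubst (H : HasLeading h a b) : MonomialSubst Exponent where
  toFun := truncComp h
  lead := leadExp a b
  rel := AddSubmonoid.closure ((relRem h).support ∪
    ((relRem (ellComp h 1)).support ∪ (relRem (ellComp h 2)).support))
  map_zero := by
    simp only [truncComp, ofLex_zero_apply, rpow_zero, tailExp_zero, single_zero_one, mul_one]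
  map_add n k := by
    have ht : HahnSeries.single (tailExp n + tailExp k) (1 : ℝ) =
        HahnSeries.single (tailExp n) 1 * HahnSeries.single (tailExp k) 1 := by
      rw [single_mul_single, mul_one]
    simp only [truncComp, ofLex_add_apply, tailExp_add]
    rw [rpow_add (H.leadingCoeff_ellComp_pos 0), rpow_add (H.leadingCoeff_ellComp_pos 1),
      rpow_add (H.leadingCoeff_ellComp_pos 2), ht]
    ring
  lead_zero := leadExp_zero a b
  lead_strictMono := leadExp_strictMono H.pos b
  rel_isPWO := H.isPWO_closure_relRem.1
  rel_nonneg := H.isPWO_closure_relRem.2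
  support_subset n p hp := by
    refine H.support_truncComp (fun t ht => ?_) (fun t ht => ?_) (Or.inr fun t ht => ?_) hp
    · exact AddSubmonoid.subset_closure (Or.inl ht)
    · exact AddSubmonoid.subset_closure (Or.inr (Or.inl ht))
    · exact AddSubmonoid.subset_closure (Or.inr (Or.inr ht))

theorem compSubst_toFun (H : HasLeading h a b) (n : Exponent) :
    H.compSubst.toFun n = truncComp h n := rfl

/-- Composition with `h` of a transseries in `x`, `ℓ` and `ℓ₂`. -/
theorem isComp_hom (H : HasLeading h a b) {f : Transseries}
    (hf : ∀ n ∈ f.support, ∀ j, 2 < j → ofLex n j = 0) :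
    IsComp f h (H.compSubst.hom f) := by
  refine ⟨H.isPosInfinitesimal, H.compSubst.family f, fun n => ?_, rfl⟩
  rw [MonomialSubst.family_apply, compSubst_toFun]
  by_cases hn : f.coeff n = 0
  · ext p
    rw [hn, HahnSeries.coeff_smul, HahnSeries.coeff_smul, zero_smul, zero_smul]
  · rw [truncComp_eq_monomialComp h (hf n hn)]

theorem truncComp_smul (H : HasLeading h a b) (r : ℝ) (n : Exponent) :
    truncComp h (r • n) = rpow (truncComp h n) r := by
  have hp := H.leadingCoeff_ellComp_pos
  have hr := fun j s => leadingCoeff_rpow_pos (hp j) s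
  rw [truncComp, truncComp, rpow_mul (leadingCoeff_mul_pos (leadingCoeff_mul_pos (hr _ _) (hr _ _))
    (hr _ _)) (by rw [leadingCoeff_of_single]; exact one_pos),
    rpow_mul (leadingCoeff_mul_pos (hr _ _) (hr _ _)) (hr _ _), rpow_mul (hr _ _) (hr _ _),
    rpow_rpow (hp _), rpow_rpow (hp _), rpow_rpow (hp _), rpow_single _ one_ne_zero, Real.one_rpow,
    tailExp_smul]
  simp only [ofLex_smul_apply, mul_comm r]

theorem hom_eq (H : HasLeading h a b) {u : Transseries} (hu : u ≠ 0) : H.compSubst.hom u =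
    HahnSeries.single 0 u.leadingCoeff * truncComp h u.order *
      (HahnSeries.single 0 1 * (1 + H.compSubst.hom (relRem u))) := by
  conv_lhs => rw [eq_single_mul_one_add_relRem hu]
  rw [map_mul, map_add, map_one, MonomialSubst.hom_single, compSubst_toFun, single_zero_one,
    one_mul, single_zero_mul_eq_smul]

/-- Write `u = c * M * (1 + ε)`. On the constant and the monomial the claim follows from the laws of
powers, and on `1 + ε` from strong linearity, which lets the endomorphism pass through the binomial
series. -/
theorem hom_rpow (H : HasLeading h a b) {u : Transseries} (hu : 0 < u.leadingCoeff) (r : ℝ) :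
    H.compSubst.hom (rpow u r) = rpow (H.compSubst.hom u) r := by
  have hu0 := ne_zero_of_leadingCoeff_pos hu
  have he := H.compSubst.orderTop_hom_pos (orderTop_relRem_pos hu0)
  have h1 : 0 < (HahnSeries.single (0 : Exponent) u.leadingCoeff).leadingCoeff := by
    rwa [leadingCoeff_of_single]
  rw [H.hom_eq hu0, rpow_mul (leadingCoeff_mul_pos h1 (H.leadingCoeff_truncComp_pos _))
    (by rw [leadingCoeff_single_mul he]; exact one_pos), rpow_mul h1
    (H.leadingCoeff_truncComp_pos _), rpow_single_mul one_ne_zero he, rpow_single _ hu.ne',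
    ← H.truncComp_smul, smul_zero, Real.one_rpow, single_zero_one, one_mul, rpow_eq,
    add_sub_cancel, map_mul, MonomialSubst.hom_single, compSubst_toFun,
    MonomialSubst.hom_heval _ (orderTop_relRem_pos hu0), single_zero_mul_eq_smul]

theorem truncComp_ellExp_one (H : HasLeading h a b) : truncComp h (ellExp 1 (-1)) = -log h := by
  rw [truncComp, tailExp_eq_zero fun j hj => by rw [ofLex_ellExp_apply, if_neg (by omega)]]
  simp only [ofLex_ellExp_apply]
  simp only [one_ne_zero, if_false, if_true, rpow_zero, single_zero_one, one_mul,
    mul_one, OfNat.one_ne_ofNat, rpow_neg_one (H.leadingCoeff_ellComp_pos 1)]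
  rw [ellComp, inv_inv, ellComp]

theorem truncComp_ellExp_two (H : HasLeading h a b) :
    truncComp h (ellExp 2 (-1)) = -log (ellComp h 1) := by
  rw [truncComp, tailExp_eq_zero fun j hj => by rw [ofLex_ellExp_apply, if_neg (by omega)]]
  simp only [ofLex_ellExp_apply]
  simp only [OfNat.ofNat_ne_zero, OfNat.ofNat_ne_one, if_false, if_true, rpow_zero,
    single_zero_one, one_mul, mul_one, rpow_neg_one (H.leadingCoeff_ellComp_pos 2)]
  rw [ellComp, inv_inv]

/-- The logarithm of `x ^ p * ℓ ^ q` involves only `ℓ⁻¹` and `ℓ₂⁻¹`, on which `truncComp` is genuine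
composition. A factor `ℓ₂` would bring in `ℓ₃`, which `truncComp` leaves fixed. -/
theorem log_truncComp (H : HasLeading h a b) {n : Exponent} (hn : ∀ j, 1 < j → ofLex n j = 0) :
    log (truncComp h n) = -H.compSubst.hom (negLogMonomial n) := by
  have h1 := eq_ellExp_add_ellExp hn
  have h2 : negLogMonomial n = HahnSeries.single (ellExp 1 (-1)) (ofLex n 0) +
      HahnSeries.single (ellExp 2 (-1)) (ofLex n 1) := by
    conv_lhs => rw [h1, negLogMonomial_add, negLogMonomial_ellExp, negLogMonomial_ellExp]
  rw [h2, map_add, MonomialSubst.hom_single, MonomialSubst.hom_single, compSubst_toFun,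
    compSubst_toFun, H.truncComp_ellExp_one, H.truncComp_ellExp_two, truncComp,
    hn 2 (by omega), tailExp_eq_zero fun j hj => hn j (by omega), rpow_zero, single_zero_one,
    mul_one, mul_one, log_mul (leadingCoeff_rpow_pos (H.leadingCoeff_ellComp_pos 0) _)
    (leadingCoeff_rpow_pos (H.leadingCoeff_ellComp_pos 1) _),
    log_rpow (H.leadingCoeff_ellComp_pos 0), log_rpow (H.leadingCoeff_ellComp_pos 1), smul_neg,
    smul_neg, neg_add, neg_neg, neg_neg]
  rfl

theorem hom_log (H : HasLeading h a b) {u : Transseries} (hu : 0 < u.leadingCoeff)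
    (hn : ∀ j, 1 < j → ofLex u.order j = 0) :
    H.compSubst.hom (log u) = log (H.compSubst.hom u) := by
  have hu0 := ne_zero_of_leadingCoeff_pos hu
  have he := H.compSubst.orderTop_hom_pos (orderTop_relRem_pos hu0)
  have h1 : 0 < (HahnSeries.single (0 : Exponent) u.leadingCoeff).leadingCoeff := by
    rwa [leadingCoeff_of_single]
  have h2 : log (HahnSeries.single 0 1 * (1 + H.compSubst.hom (relRem u))) =
      heval (H.compSubst.hom (relRem u)) (PowerSeries.log ℝ) := by
    rw [log_eq, leadingCoeff_single_mul he, order_single_mul one_ne_zero he,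
      relRem_single_mul one_ne_zero he, Real.log_one, map_zero, negLogMonomial]
    simp
  have h3 : negLogMonomial 0 = 0 := by simp [negLogMonomial]
  rw [H.hom_eq hu0, log_mul (leadingCoeff_mul_pos h1 (H.leadingCoeff_truncComp_pos _))
    (by rw [leadingCoeff_single_mul he]; exact one_pos), log_mul h1
    (H.leadingCoeff_truncComp_pos _), h2, log_single _ hu.ne', h3, H.log_truncComp hn, log_eq,
    map_add, map_sub, MonomialSubst.hom_C, MonomialSubst.hom_heval _ (orderTop_relRem_pos hu0)]
  ring

/-- Associativity of composition on monomials in `x` and `ℓ`: the endomorphism commutes with powers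
and with the one logarithm in `ℓ ∘ k`. -/
theorem hom_monomialComp (H : HasLeading h a b) {k : Transseries} {a' b' : ℝ}
    (K : HasLeading k a' b') {n : Exponent}
    (hn : ∀ j, 1 < j → ofLex n j = 0) :
    H.compSubst.hom (monomialComp k n) = monomialComp (H.compSubst.hom k) n := by
  have hn' : ∀ j ∉ Finset.range 2, ofLex n j = 0 := fun j hj => hn j (by simpa using hj)
  have hk : ∀ j, 1 < j → ofLex k.order j = 0 := fun j hj => by
    rw [K.order_eq, ofLex_expo_apply, if_neg (by omega), if_neg (by omega)]; simp
  have h1 : H.compSubst.hom (ellComp k 1) = ellComp (H.compSubst.hom k) 1 := by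
    rw [ellComp, ellComp, ellComp, ellComp, map_inv₀, map_neg, H.hom_log K.leadingCoeff_pos hk]
  rw [monomialComp_eq_prod k hn', monomialComp_eq_prod _ hn', Finset.prod_range_succ,
    Finset.prod_range_succ, Finset.prod_range_zero, one_mul, Finset.prod_range_succ,
    Finset.prod_range_succ, Finset.prod_range_zero, one_mul, map_mul,
    H.hom_rpow (K.leadingCoeff_ellComp_pos 0), H.hom_rpow (K.leadingCoeff_ellComp_pos 1), h1]
  rfl

theorem hom_idT (H : HasLeading h a b) : H.compSubst.hom idT = h := by
  rw [idT, MonomialSubst.hom_single, one_smul, compSubst_toFun, truncComp,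
    tailExp_eq_zero fun j hj => by rw [ofLex_ellExp_apply, if_neg (by omega)]]
  simp only [ofLex_ellExp_apply]
  simp only [zero_ne_one, if_false, if_true, rpow_zero, single_zero_one, mul_one,
    OfNat.zero_ne_ofNat]
  rw [ellComp, rpow_one H.ne_zero]

end HasLeading

theorem monomialComp_idT {n : Exponent} (hn : ∀ j, 1 < j → ofLex n j = 0) :
    monomialComp idT n = HahnSeries.single n 1 := by
  have h1 : ellComp idT 1 = HahnSeries.single (ellExp 1 1) 1 := by
    rw [ellComp, ellComp, idT, log_single _ one_ne_zero, negLogMonomial_ellExp, Real.log_one,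
      map_zero, zero_sub, neg_neg, inv_single, neg_ellExp, neg_neg, inv_one]
  rw [monomialComp_eq_prod idT (s := Finset.range 2) fun j hj => hn j (by simpa using hj),
    Finset.prod_range_succ, Finset.prod_range_succ, Finset.prod_range_zero, one_mul, h1, ellComp,
    idT, rpow_single _ one_ne_zero, rpow_single _ one_ne_zero, Real.one_rpow, Real.one_rpow,
    single_mul_single, mul_one, smul_ellExp, smul_ellExp, mul_one, mul_one]
  rw [← eq_ellExp_add_ellExp hn]

/-- A left inverse in `x`, `ℓ` and `ℓ₂` of a transseries in `x` and `ℓ` is a two-sided inverse. -/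
theorem isFormalInverse_of_hom_eq {g h : Transseries} {a b a' b' : ℝ} (G : HasLeading g a b)
    (H : HasLeading h a' b') (hg : ∀ n ∈ g.support, ∀ j, 1 < j → ofLex n j = 0)
    (hh : ∀ n ∈ h.support, ∀ j, 2 < j → ofLex n j = 0) (hinv : G.compSubst.hom h = idT) :
    IsFormalInverse g h := by
  have hg' : ∀ n ∈ g.support, ∀ j, 2 < j → ofLex n j = 0 := fun n hn j hj =>
    hg n hn j (by omega)
  have h1 := H.isComp_hom hg'
  have h2 := G.isComp_hom hh
  rw [hinv] at h2
  -- After composition with `g` on the right, which is injective, this reads `g ∘ (h ∘ g) = g`, and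
  -- it is checked term by term with `h ∘ g = x`.
  have h3 : H.compSubst.hom g = idT := by
    refine G.compSubst.hom.injective ?_
    rw [G.hom_idT, MonomialSubst.hom_apply, MonomialSubst.hom_apply,
      show H.compSubst.subst g = (H.compSubst.family g).hsum from rfl,
      MonomialSubst.subst_hsum]
    conv_rhs => rw [← hsum_termFamily g]
    congr 1
    ext1 n
    rw [MonomialSubst.mapFamily_apply, MonomialSubst.family_apply, H.compSubst_toFun,
      MonomialSubst.subst_smul, termFamily_apply]
    by_cases hn : g.coeff n = 0
    · rw [hn, single_eq_zero, ← HahnSeries.C_mul_eq_smul, map_zero, zero_mul]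
    · rw [truncComp_eq_monomialComp h (hg' n hn), ← MonomialSubst.hom_apply,
        G.hom_monomialComp H (hg n hn), hinv, monomialComp_idT (hg n hn),
        ← HahnSeries.C_mul_eq_smul]
      change HahnSeries.single 0 (g.coeff n) * HahnSeries.single n 1 = _
      rw [single_mul_single, zero_add, mul_one]
  rw [h3] at h1
  exact ⟨h1, h2⟩

end Composition

/-! ### Discreteness of exponents and membership in `LInfty` -/

section Sequential

theorem exists_least_of_finite_below {T : Set ℝ} (hT : ∀ B, (T ∩ Set.Iic B).Finite)
    (hne : T.Nonempty) : ∃ s ∈ T, ∀ t ∈ T, s ≤ t := by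
  obtain ⟨B, hB⟩ := hne
  obtain ⟨s, hs, h⟩ := Set.exists_min_image (T ∩ Set.Iic B) id (hT B) ⟨B, hB, Set.mem_Iic.2 le_rfl⟩
  refine ⟨s, hs.1, fun t ht => ?_⟩
  rcases le_or_gt t B with h1 | h1
  · exact h t ⟨ht, h1⟩
  · exact le_trans hs.2 h1.le

theorem isSequential_of_finite_below {S : Set ℝ} (hS : ∀ B, (S ∩ Set.Iic B).Finite) :
    IsSequential S := by
  -- Adjoining the natural numbers makes the set unbounded, so the enumeration never stops even if
  -- `S` is finite or empty.
  let T : Set ℝ := S ∪ Set.range (Nat.cast : ℕ → ℝ)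
  have hT : ∀ B, (T ∩ Set.Iic B).Finite := fun B => by
    rw [Set.union_inter_distrib_right]
    refine (hS B).union (((Set.finite_Iic ⌊B⌋₊).image (Nat.cast : ℕ → ℝ)).subset ?_)
    rintro _ ⟨⟨n, rfl⟩, hn⟩
    exact ⟨n, Nat.le_floor hn, rfl⟩
  obtain ⟨t₀, ht₀, hmin⟩ := exists_least_of_finite_below hT ⟨(0 : ℕ), Or.inr ⟨0, rfl⟩⟩
  have hnext : ∀ t : ℝ, ∃ s ∈ T ∩ Set.Ioi t, ∀ s' ∈ T ∩ Set.Ioi t, s ≤ s' := fun t => by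
    refine exists_least_of_finite_below (fun B => (hT B).subset fun s hs => ⟨hs.1.1, hs.2⟩) ?_
    obtain ⟨n, hn⟩ := exists_nat_gt t
    exact ⟨n, Or.inr ⟨n, rfl⟩, hn⟩
  choose next hnextT hnextmin using hnext
  let u : ℕ → ℝ := fun n => next^[n] t₀
  have hu : ∀ n, u (n + 1) = next (u n) := fun n => Function.iterate_succ_apply' next n t₀
  have huT : ∀ n, u n ∈ T := fun n => by
    cases n with
    | zero => exact ht₀
    | succ n => rw [hu]; exact (hnextT _).1
  have humono : StrictMono u := strictMono_nat_of_lt_succ fun n => by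
    rw [hu]; exact (hnextT _).2
  have htends : Filter.Tendsto u Filter.atTop Filter.atTop := by
    refine Filter.tendsto_atTop_atTop_of_monotone humono.monotone fun B => ?_
    by_contra! hB
    exact Set.infinite_of_injective_forall_mem humono.injective
      (fun n => (⟨huT n, (hB n).le⟩ : u n ∈ T ∩ Set.Iic B)) (hT B)
  refine ⟨u, humono, htends, fun s hs => ?_⟩
  classical
  have hex : ∃ n, s ≤ u n := (htends.eventually_ge_atTop s).exists
  have h1 := Nat.find_spec hex
  rcases hn : Nat.find hex with - | n
  · rw [hn] at h1
    exact ⟨0, le_antisymm (hmin s (Or.inl hs)) h1⟩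
  · rw [hn] at h1
    have h2 : u n < s := not_le.1 (Nat.find_min hex (by omega))
    refine ⟨n + 1, le_antisymm ?_ h1⟩
    rw [hu]
    exact hnextmin _ s ⟨Or.inl hs, h2⟩

theorem IsSequential.finite_below {S : Set ℝ} (hS : IsSequential S) (B : ℝ) :
    (S ∩ Set.Iic B).Finite := by
  obtain ⟨u, -, ht, hsub⟩ := hS
  obtain ⟨N, hN⟩ := Filter.eventually_atTop.1 (ht.eventually_gt_atTop B)
  refine ((Set.finite_Iio N).image u).subset ?_
  rintro s ⟨hs, hsB⟩
  obtain ⟨n, rfl⟩ := hsub hs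
  exact ⟨n, not_le.1 fun h => absurd hsB (not_le.2 (hN n h)), rfl⟩

/-- Positive generators not above `B` are bounded below by some `d > 0`. Removing one of them from a
sum lowers it by at least `d`, so induction on `N` handles the elements below `N * d`. -/
theorem finite_below_closure {G : Set ℝ} (hG0 : ∀ t ∈ G, 0 ≤ t)
    (hG : ∀ B, (G ∩ Set.Iic B).Finite) (B : ℝ) :
    ((AddSubmonoid.closure G : Set ℝ) ∩ Set.Iic B).Finite := by
  have hnonneg : ∀ t ∈ AddSubmonoid.closure G, 0 ≤ t := fun t ht =>
    (AddSubmonoid.closure_le (S := AddSubmonoid.nonneg ℝ)).2 hG0 ht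
  obtain ⟨d, hd, hmin⟩ : ∃ d > 0, ∀ t ∈ G, 0 < t → t ≤ B → d ≤ t := by
    by_cases hne : (G ∩ Set.Ioc 0 B).Nonempty
    · obtain ⟨d, hd, h⟩ := Set.exists_min_image (G ∩ Set.Ioc 0 B) id
        ((hG B).subset fun t ht => ⟨ht.1, ht.2.2⟩) hne
      exact ⟨d, hd.2.1, fun t ht h0 hB => h t ⟨ht, h0, hB⟩⟩
    · exact ⟨1, one_pos, fun t ht h0 hB => absurd ⟨t, ht, h0, hB⟩ hne⟩
  have key : ∀ N : ℕ, {t ∈ AddSubmonoid.closure G | t ≤ B ∧ t < N * d}.Finite := by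
    intro N
    induction N with
    | zero =>
      refine Set.finite_empty.subset fun t ht => ?_
      have := ht.2.2
      have := hnonneg t ht.1
      simp at *
      linarith
    | succ N ih =>
      refine ((Set.finite_singleton (0 : ℝ)).union
        (((hG B).prod ih).image fun p => p.1 + p.2)).subset ?_
      rintro t ⟨ht, hB, hN⟩
      suffices h : t = 0 ∨ ∃ s ∈ G, 0 < s ∧ ∃ s' ∈ AddSubmonoid.closure G, t = s + s' by
        rcases h with rfl | ⟨s, hs, hs0, s', hs', rfl⟩
        · exact Or.inl rfl
        · have h' := hnonneg s' hs'
          have hsB : s ≤ B := by linarith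
          have := hmin s hs hs0 hsB
          refine Or.inr ⟨(s, s'), ⟨⟨hs, hsB⟩, hs', by linarith, ?_⟩, rfl⟩
          push_cast at hN
          linarith
      clear hB hN
      induction ht using AddSubmonoid.closure_induction with
      | mem x hx =>
        rcases (hG0 x hx).eq_or_lt with h | h
        · exact Or.inl h.symm
        · exact Or.inr ⟨x, hx, h, 0, AddSubmonoid.zero_mem _, (add_zero x).symm⟩
      | zero => exact Or.inl rfl
      | add x y hx hy hx' hy' =>
        rcases hx' with rfl | ⟨s, hs, hs0, s', hs', rfl⟩
        · rwa [zero_add]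
        · exact Or.inr ⟨s, hs, hs0, s' + y, AddSubmonoid.add_mem _ hs' hy, add_assoc s s' y⟩
  obtain ⟨N, hN⟩ := exists_nat_gt (B / d)
  refine (key N).subset fun t ht => ⟨ht.1, ht.2, lt_of_le_of_lt ht.2 ?_⟩
  exact (div_lt_iff₀ hd).1 hN

/-- With the earlier exponents fixed, the exponents of `ℓ_k` are bounded below because the support
is well-ordered, and they lie in one coset of `ℤ`; hence there are finitely many below any bound. -/
theorem mem_LInfty {f : Transseries} {j : ℕ}
    (hdepth : ∀ n ∈ f.support, ∀ k, j < k → ofLex n k = 0)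
    (hfin : ∀ B, ({t | ∃ n ∈ f.support, ofLex n 0 = t} ∩ Set.Iic B).Finite)
    (hcoset : ∀ k, 1 ≤ k → k ≤ j → ∀ p : ℕ → ℝ, ∃ θ : ℝ, ∀ n ∈ f.support,
      (∀ i < k, ofLex n i = p i) → ∃ z : ℤ, ofLex n k = θ + z) : f ∈ LInfty j := by
  refine ⟨hdepth, fun k hk p => isSequential_of_finite_below fun B => ?_⟩
  rcases Nat.eq_zero_or_pos k with rfl | hk0
  · refine (hfin B).subset ?_
    rintro t ⟨⟨n, hn, -, rfl⟩, hB⟩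
    exact ⟨⟨n, hn, rfl⟩, hB⟩
  obtain ⟨θ, hθ⟩ := hcoset k hk0 hk p
  set S := {t | ∃ n ∈ f.support, (∀ i < k, ofLex n i = p i) ∧ ofLex n k = t} with hS
  rcases S.eq_empty_or_nonempty with h0 | hne
  · rw [h0, Set.empty_inter]; exact Set.finite_empty
  -- On exponents that agree before place `k`, the lexicographic order makes the `k`-th coordinate
  -- monotone.
  have hPWO : S.IsPWO := by
    have h1 : {n ∈ f.support | ∀ i < k, ofLex n i = p i}.IsPWO :=
      f.isPWO_support.mono fun n hn => hn.1
    refine (h1.image_of_monotoneOn (f := fun n => ofLex n k) ?_).mono ?_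
    · intro n hn n' hn' hle
      rcases hle.eq_or_lt with rfl | hlt
      · exact le_rfl
      obtain ⟨i, hi, hlt⟩ := exponent_lt_iff.1 hlt
      rcases lt_trichotomy i k with h | rfl | h
      · rw [hn.2 i h, hn'.2 i h] at hlt
        exact absurd hlt (lt_irrefl _)
      · exact hlt.le
      · exact (hi k h).le
    · rintro t ⟨n, hn, hp, rfl⟩
      exact ⟨n, ⟨hn, hp⟩, rfl⟩
  set c := hPWO.isWF.min hne with hc
  refine ((Set.finite_Icc ⌈c - θ⌉ ⌊B - θ⌋).image fun z : ℤ => θ + z).subset ?_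
  rintro t ⟨ht, hB⟩
  have hct : c ≤ t := hPWO.isWF.min_le hne ht
  obtain ⟨n, hn, hp, rfl⟩ := ht
  obtain ⟨z, hz⟩ := hθ n hn hp
  rw [Set.mem_Iic] at hB
  exact ⟨z, ⟨Int.ceil_le.2 (by linarith), Int.le_floor.2 (by linarith)⟩, hz.symm⟩

end Sequential

/-! ### Uniqueness of left inverses -/

section Uniqueness

variable {g : Transseries} {a b : ℝ}

theorem leadExp_add (a b : ℝ) (n k : Exponent) :
    leadExp a b (n + k) = leadExp a b n + leadExp a b k := by
  refine exponent_ext fun j => ?_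
  simp only [leadExp, ofLex_add_apply, ofLex_expo_apply]
  split_ifs <;> ring

theorem leadExp_leadExp_inv (ha : a ≠ 0) (b : ℝ) (n : Exponent) :
    leadExp a b (leadExp a⁻¹ (-b / a) n) = n := by
  refine exponent_ext fun j => ?_
  rcases j with - | - | j
  · rw [ofLex_leadExp_zero, ofLex_leadExp_zero, mul_inv_cancel_left₀ ha]
  · rw [zero_add, ofLex_leadExp_one, ofLex_leadExp_one, ofLex_leadExp_zero]
    field_simp
    ring
  · rw [ofLex_leadExp_of_two_le _ _ _ (by omega), ofLex_leadExp_of_two_le _ _ _ (by omega)]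

theorem leadExp_inv_leadExp (ha : a ≠ 0) (b : ℝ) (n : Exponent) :
    leadExp a⁻¹ (-b / a) (leadExp a b n) = n := by
  refine exponent_ext fun j => ?_
  rcases j with - | - | j
  · rw [ofLex_leadExp_zero, ofLex_leadExp_zero, inv_mul_cancel_left₀ ha]
  · rw [zero_add, ofLex_leadExp_one, ofLex_leadExp_one, ofLex_leadExp_zero]
    field_simp
    ring
  · rw [ofLex_leadExp_of_two_le _ _ _ (by omega), ofLex_leadExp_of_two_le _ _ _ (by omega)]

/-- This concerns the full composition, not `truncComp`, since a competing inverse may contain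
iterated logarithms of any depth. -/
theorem HasLeading.monomialComp_leading (G : HasLeading g a b) (n : Exponent) :
    0 < (monomialComp g n).leadingCoeff ∧ (monomialComp g n).order = leadExp a b n := by
  obtain ⟨f, rfl⟩ := toLex.surjective n
  induction f using Finsupp.induction_linear with
  | zero =>
    have : monomialComp g (toLex 0) = 1 := by simp [monomialComp]
    rw [this, toLex_zero, leadExp_zero]
    simp
  | add p q hp hq =>
    have : monomialComp g (toLex (p + q)) = monomialComp g (toLex p) * monomialComp g (toLex q) :=
      Finsupp.prod_add_index' (fun j => rpow_zero _)
        fun j r s => rpow_add (G.leadingCoeff_ellComp_pos j) r s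
    rw [this, toLex_add, leadExp_add, order_mul (ne_zero_of_leadingCoeff_pos hp.1)
      (ne_zero_of_leadingCoeff_pos hq.1), hp.2, hq.2]
    exact ⟨leadingCoeff_mul_pos hp.1 hq.1, rfl⟩
  | single j r =>
    have : monomialComp g (toLex (Finsupp.single j r)) = rpow (ellComp g j) r :=
      Finsupp.prod_single_index (rpow_zero _)
    rw [this, order_rpow (G.leadingCoeff_ellComp_pos j)]
    refine ⟨leadingCoeff_rpow_pos (G.leadingCoeff_ellComp_pos j) r, ?_⟩
    change _ = leadExp a b (ellExp j r)
    refine exponent_ext fun i => ?_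
    rcases j with - | j
    · rw [ellComp, G.order_eq]
      simp only [leadExp, ofLex_add_apply, ofLex_smul_apply, ofLex_expo_apply, ofLex_ellExp_apply]
      split_ifs <;> simp <;> ring
    · rw [(G.ellComp_succ j).2]
      simp only [leadExp, ofLex_add_apply, ofLex_smul_apply, ofLex_expo_apply, ofLex_ellExp_apply]
      simp

/-- The leading exponents of the composed monomials are strictly increasing, so the leading term of
`f - f'` cannot cancel in `(f - f') ∘ g`. -/
theorem IsComp.left_unique (G : HasLeading g a b) {f f' k : Transseries} (hf : IsComp f g k)
    (hf' : IsComp f' g k) : f = f' := by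
  obtain ⟨-, s, hs, hsk⟩ := hf
  obtain ⟨-, s', hs', hsk'⟩ := hf'
  by_contra hne
  have hd : f - f' ≠ 0 := sub_ne_zero.2 hne
  set n := (f - f').order with hn
  have hterm : ∀ i, (s - s') i = (f - f').coeff i • monomialComp g i := fun i => by
    ext p
    rw [SummableFamily.sub_apply, hs, hs', HahnSeries.coeff_sub, HahnSeries.coeff_smul,
      HahnSeries.coeff_smul, HahnSeries.coeff_smul, HahnSeries.coeff_sub, sub_smul]
  have h0 : (s - s').hsum.coeff (leadExp a b n) = 0 := by
    rw [hsum_sub, hsk, hsk', sub_self, HahnSeries.coeff_zero]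
  rw [coeff_hsum, finsum_eq_single _ n fun i hi => ?_] at h0
  · rw [hterm, HahnSeries.coeff_smul, ← (G.monomialComp_leading n).2, ← leadingCoeff_eq, hn,
      ← leadingCoeff_eq] at h0
    exact mul_ne_zero (leadingCoeff_ne_zero.2 hd) (G.monomialComp_leading n).1.ne' h0
  · rw [hterm, HahnSeries.coeff_smul]
    rcases lt_or_gt_of_ne hi with h | h
    · rw [coeff_eq_zero_of_lt_order h, zero_smul]
    · rw [coeff_eq_zero_of_lt_order (x := monomialComp g i), smul_zero]
      rw [(G.monomialComp_leading i).2]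
      exact leadExp_strictMono G.pos b h

end Uniqueness

/-! ### Construction of the left inverse -/

section LeftInverse

variable {g : Transseries} {a b : ℝ}

theorem leadExp_ellExp_zero (a b : ℝ) : leadExp a b (ellExp 0 1) = expo a b 0 := by
  refine exponent_ext fun i => ?_
  simp only [leadExp, ofLex_add_apply, ofLex_expo_apply, ofLex_ellExp_apply, if_true, mul_one]
  split_ifs <;> ring

/-- A left inverse for composition, with its leading term and the support of its remainder. -/
theorem HasLeading.exists_left_inverse (G : HasLeading g a b) {M : AddSubmonoid Exponent}
    (hM : (M : Set Exponent).IsPWO) (hM0 : ∀ t ∈ M, 0 ≤ t) (h0 : relRem g ∈ supportedIn M)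
    (h1 : relRem (ellComp g 1) ∈ supportedIn M)
    (h2 : (∀ t ∈ M, ofLex t 2 = 0) ∨ relRem (ellComp g 2) ∈ supportedIn M) :
    ∃ h : Transseries, G.compSubst.hom h = idT ∧
      h.leadingCoeff = (g.leadingCoeff ^ a⁻¹ * a⁻¹ ^ (-b / a))⁻¹ ∧
      h.order = expo a⁻¹ (-b / a) 0 ∧
      ∀ n ∈ h.support, ∃ q ∈ M, n = expo a⁻¹ (-b / a) 0 + leadExp a⁻¹ (-b / a) q := by
  set ψ := leadExp a⁻¹ (-b / a) with hψ
  set e := ellExp 0 1 with he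
  have ha := G.pos.ne'
  have hmono : StrictMono ψ := leadExp_strictMono (inv_pos.2 G.pos) _
  have hinv : ∀ n, leadExp a b (ψ n) = n := leadExp_leadExp_inv ha b
  have hinv' : ∀ n, ψ (leadExp a b n) = n := leadExp_inv_leadExp ha b
  have hψe : ∀ q, ψ (e + q) = expo a⁻¹ (-b / a) 0 + ψ q := fun q => by
    rw [hψ, leadExp_add, he, leadExp_ellExp_zero]
  -- The monomial with exponent `ψ (e + q)` has leading exponent `e + q` after composition with `g`.
  -- Division by `x` turns `h ∘ g = x` into `∑ c q * F q = 1`, triangular over `M`.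
  let F : Exponent → Transseries := fun q => HahnSeries.single (-e) 1 * truncComp g (ψ (e + q))
  have hFcoeff : ∀ q p, (F q).coeff p = (truncComp g (ψ (e + q))).coeff (e + p) := fun q p => by
    rw [coeff_single_mul, one_mul, sub_neg_eq_add, add_comm p]
  have hF : ∀ q ∈ M, ∀ p ∈ (F q).support, ∃ t ∈ M, q + t = p := fun q hq p hp => by
    rw [HahnSeries.mem_support, hFcoeff] at hp
    have h2' : ofLex (ψ (e + q)) 2 = 0 ∨ relRem (ellComp g 2) ∈ supportedIn M := by
      refine h2.imp_left fun h => ?_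
      rw [hψ, ofLex_leadExp_of_two_le _ _ _ le_rfl, ofLex_add_apply, h q hq, he,
        ofLex_ellExp_apply]
      simp
    obtain ⟨t, ht, h⟩ := G.support_truncComp h0 h1 h2' hp
    rw [hinv, add_assoc, add_right_inj] at h
    exact ⟨t, ht, h⟩
  have hFlead : ∀ q, (F q).coeff q =
      g.leadingCoeff ^ ofLex (ψ (e + q)) 0 * a⁻¹ ^ ofLex (ψ (e + q)) 1 := fun q => by
    rw [hFcoeff, ← G.coeff_truncComp_leadExp, hinv]
  have hFpos : ∀ q, (F q).coeff q ≠ 0 := fun q => by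
    rw [hFlead]
    exact (mul_pos (Real.rpow_pos_of_pos G.leadingCoeff_pos _)
      (Real.rpow_pos_of_pos (inv_pos.2 G.pos) _)).ne'
  obtain ⟨c, hcM, hc⟩ := exists_triangular_solution hM hM0 hF fun q _ => hFpos q
  -- The equation at `0`, where only `q = 0` contributes; it yields the leading coefficient of the
  -- inverse.
  have hc0 : c 0 * (F 0).coeff 0 = 1 := by
    have := hc 0
    rw [finsum_eq_single _ 0 fun q hq => ?_] at this
    · rw [this]; simp
    · by_contra hne
      have hqM := hcM q (left_ne_zero_of_mul hne)
      obtain ⟨t, ht, h⟩ := hF q hqM 0 (right_ne_zero_of_mul hne)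
      exact hq (le_antisymm (by rw [← h]; exact le_add_of_nonneg_right (hM0 t ht)) (hM0 q hqM))
  -- The series with coefficient `c q` at `ψ (e + q)`, written through the inverse bijection.
  let h : Transseries :=
    { coeff := fun n => c (leadExp a b n - e)
      isPWO_support' := by
        have h1 : (ψ '' ((fun q => e + q) '' (M : Set Exponent))).IsPWO :=
          (hM.image_of_monotone fun x y hxy => add_le_add_right hxy e).image_of_monotone
            hmono.monotone
        refine h1.mono fun n hn => ⟨leadExp a b n, ⟨leadExp a b n - e, hcM _ hn, ?_⟩, hinv' n⟩
        exact add_sub_cancel _ _ }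
  have hcoeff : ∀ n, h.coeff n = c (leadExp a b n - e) := fun n => rfl
  have hsupp : ∀ n ∈ h.support, ∃ q ∈ M, n = expo a⁻¹ (-b / a) 0 + ψ q := fun n hn => by
    refine ⟨leadExp a b n - e, hcM _ hn, ?_⟩
    rw [← hψe, add_sub_cancel, hinv']
  have hn0 : h.coeff (expo a⁻¹ (-b / a) 0) = c 0 := by
    rw [hcoeff, ← leadExp_ellExp_zero, ← hψ, hinv, sub_self]
  have hcne : c 0 ≠ 0 := left_ne_zero_of_mul (hc0 ▸ one_ne_zero)
  have hne : h ≠ 0 := ne_zero_of_coeff_ne_zero (g := expo a⁻¹ (-b / a) 0) (by rwa [hn0])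
  have hord : h.order = expo a⁻¹ (-b / a) 0 := by
    refine le_antisymm (order_le_of_coeff_ne_zero (by rwa [hn0])) ?_
    obtain ⟨q, hq, hq'⟩ := hsupp h.order (by
      rw [HahnSeries.mem_support, ← leadingCoeff_eq]; exact leadingCoeff_ne_zero.2 hne)
    rw [hq']
    refine le_add_of_nonneg_right ?_
    rw [← leadExp_zero a⁻¹ (-b / a)]
    exact hmono.monotone (hM0 q hq)
  refine ⟨h, ?_, ?_, hord, hsupp⟩
  · ext p
    rw [MonomialSubst.hom_apply, MonomialSubst.coeff_subst]
    let E : Exponent ≃ Exponent :=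
      { toFun := fun q => ψ (e + q)
        invFun := fun n => leadExp a b n - e
        left_inv := fun q => by simp only [hinv, add_sub_cancel_left]
        right_inv := fun n => by simp only [add_sub_cancel, hinv'] }
    rw [← finsum_comp_equiv E]
    have hE : ∀ q, h.coeff (E q) * (G.compSubst.toFun (E q)).coeff p =
        c q * (F q).coeff (p - e) := fun q => by
      rw [hFcoeff, add_sub_cancel, hcoeff]
      change c (leadExp a b (ψ (e + q)) - e) * _ = _
      rw [hinv, add_sub_cancel_left]
      rfl
    rw [finsum_congr hE, hc, HahnSeries.coeff_one, idT, ← he]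
    by_cases hp : p = e
    · rw [hp, sub_self, if_pos rfl, coeff_single_same]
    · rw [if_neg (sub_ne_zero.2 hp), coeff_single_of_ne hp]
  · rw [leadingCoeff_eq, hord, hn0, eq_inv_of_mul_eq_one_left hc0, hFlead, hψe, hψ, leadExp_zero,
      add_zero, ofLex_expo_apply, ofLex_expo_apply]
    simp

theorem support_relRem_of_support {h : Transseries} (hh : h ≠ 0) {ψ : Exponent → Exponent}
    (hψ : ψ 0 = 0) {M : AddSubmonoid Exponent}
    (hsupp : ∀ n ∈ h.support, ∃ q ∈ M, n = h.order + ψ q) :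
    ∀ n ∈ (relRem h).support, ∃ q ∈ M, q ≠ 0 ∧ n = ψ q := by
  intro n hn
  have hpos := pos_of_mem_support (orderTop_relRem_pos hh) hn
  have h1 : h.coeff (h.order + n) ≠ 0 := by
    rw [HahnSeries.mem_support, relRem, HahnSeries.coeff_sub, HahnSeries.coeff_one,
      if_neg hpos.ne', sub_zero, coeff_single_mul, sub_neg_eq_add, add_comm] at hn
    exact right_ne_zero_of_mul hn
  obtain ⟨q, hq, h2⟩ := hsupp _ h1
  rw [add_right_inj] at h2
  refine ⟨q, hq, ?_, h2⟩
  rintro rfl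
  exact hpos.ne' (h2.trans hψ)

end LeftInverse

/-! ### Exponents of `g` relative to the leading one -/

section Support

theorem expo_add (a b c a' b' c' : ℝ) :
    expo a b c + expo a' b' c' = expo (a + a') (b + b') (c + c') := by
  simp only [expo, ellExp_add]; abel

/-- The exponents of `g` other than the leading one, relative to the leading one. -/
def relExp (g : Transseries) : Set Exponent := {q | q ≠ 0 ∧ g.order + q ∈ g.support}

variable {g : Transseries}

theorem relRem_mem_of_relExp {M : AddSubmonoid Exponent} (hg : g ≠ 0) (hM : relExp g ⊆ M) :
    relRem g ∈ supportedIn M := by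
  intro n hn
  have hpos := pos_of_mem_support (orderTop_relRem_pos hg) hn
  refine hM ⟨hpos.ne', ?_⟩
  rw [HahnSeries.mem_support, relRem, HahnSeries.coeff_sub, HahnSeries.coeff_one,
    if_neg hpos.ne', sub_zero, coeff_single_mul, sub_neg_eq_add, add_comm] at hn
  exact right_ne_zero_of_mul hn

theorem relExp_isPWO : (relExp g).IsPWO := by
  refine (g.isPWO_support.image_of_monotone (f := fun n => n - g.order)
    fun x y h => sub_le_sub_right h _).mono ?_
  rintro q ⟨-, hq⟩
  exact ⟨_, hq, add_sub_cancel_left _ _⟩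

theorem relExp_nonneg {q : Exponent} (hq : q ∈ relExp g) : 0 ≤ q :=
  (le_add_iff_nonneg_right g.order).1 (order_le_of_coeff_ne_zero hq.2)

theorem exists_mem_supp_of_mem_relExp {α : ℝ} {m : ℤ} (hg : g ∈ LHat)
    (horder : g.order = expo α m 0) {q : Exponent} (hq : q ∈ relExp g) :
    ∃ p ∈ supp g \ {(α, m)}, q = expo (p.1 - α) ((p.2 - m : ℤ) : ℝ) 0 := by
  obtain ⟨hq0, hn⟩ := hq
  obtain ⟨z, hz⟩ := hg.2 _ hn
  set n := g.order + q with hndef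
  have hn' : n = expo (ofLex n 0) z 0 := by
    rw [expo_zero, ← hz]
    exact eq_ellExp_add_ellExp fun j hj => hg.1.1.1 n hn j hj
  have hq' : q = expo (ofLex n 0 - α) ((z - m : ℤ) : ℝ) 0 := by
    have h1 : q = n - g.order := by rw [hndef, add_sub_cancel_left]
    rw [h1, horder, sub_eq_iff_eq_add, expo_add]
    conv_lhs => rw [hn']
    push_cast
    congr 1 <;> ring
  refine ⟨(ofLex n 0, z), ⟨?_, ?_⟩, hq'⟩
  · change g.coeff (expo (ofLex n 0) z 0) ≠ 0
    rw [← hn']; exact hn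
  · intro h
    obtain ⟨h1, h2⟩ := Prod.mk.inj (Set.mem_singleton_iff.1 h)
    rw [h1, h2] at hq'
    apply hq0
    rw [hq', sub_self, sub_self, Int.cast_zero, expo, ellExp_zero, ellExp_zero, ellExp_zero,
      add_zero, add_zero]

variable {E : Set Exponent}

theorem isPWO_closure_relExp_union (hE : E.Finite) (hE0 : ∀ q ∈ E, 0 ≤ q) :
    (AddSubmonoid.closure (relExp g ∪ E) : Set Exponent).IsPWO ∧
      ∀ t ∈ AddSubmonoid.closure (relExp g ∪ E), 0 ≤ t := by
  have h0 : ∀ t ∈ relExp g ∪ E, 0 ≤ t := by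
    rintro t (ht | ht)
    exacts [relExp_nonneg ht, hE0 t ht]
  exact ⟨Set.IsPWO.addSubmonoid_closure h0 (relExp_isPWO.union hE.isPWO), fun t ht =>
    (AddSubmonoid.closure_le (S := AddSubmonoid.nonneg Exponent)).2 h0 ht⟩

/-- In the exponent of `x` the elements of `E` are invisible, and the relative exponents of `g` are
nonnegative and discrete; sums of such numbers are again discrete. -/
theorem finite_below_closure_relExp_union (hg : g ∈ LHat) (hE : ∀ q ∈ E, ofLex q 0 = 0) (B : ℝ) :
    ({t | ∃ q ∈ AddSubmonoid.closure (relExp g ∪ E), ofLex q 0 = t} ∩ Set.Iic B).Finite := by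
  let T : Set ℝ := insert 0 {t | ∃ q ∈ relExp g, ofLex q 0 = t}
  have hT0 : ∀ t ∈ T, 0 ≤ t := by
    rintro t (rfl | ⟨q, hq, rfl⟩)
    · exact le_rfl
    · rcases (relExp_nonneg hq).eq_or_lt with h | h
      · rw [← h]; exact le_rfl
      · obtain ⟨i, hi, hlt⟩ := exponent_lt_iff.1 h
        rcases Nat.eq_zero_or_pos i with rfl | hi0
        · exact hlt.le
        · exact (hi 0 hi0).le
  have hT : ∀ B, (T ∩ Set.Iic B).Finite := fun B => by
    have h1 := (hg.1.1.2 0 (Nat.zero_le 1) 0).finite_below (ofLex g.order 0 + B)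
    refine ((h1.image fun t => t - ofLex g.order 0).insert 0).subset ?_
    rintro t ⟨rfl | ⟨q, hq, rfl⟩, hB⟩
    · exact Set.mem_insert _ _
    · refine Set.mem_insert_of_mem _ ⟨ofLex (g.order + q) 0, ⟨⟨_, hq.2, ?_, rfl⟩, ?_⟩, ?_⟩
      · exact fun i hi => absurd hi (Nat.not_lt_zero i)
      · exact Set.mem_Iic.2 ((add_le_add_iff_left _).2 (Set.mem_Iic.1 hB))
      · exact add_sub_cancel_left _ _
  refine (finite_below_closure hT0 hT B).subset ?_
  rintro _ ⟨⟨q, hq, rfl⟩, hB⟩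
  refine ⟨?_, hB⟩
  clear hB
  induction hq using AddSubmonoid.closure_induction with
  | mem x hx =>
    rcases hx with hx | hx
    · exact AddSubmonoid.subset_closure (Set.mem_insert_of_mem _ ⟨x, hx, rfl⟩)
    · rw [hE x hx]; exact AddSubmonoid.zero_mem _
  | zero => exact AddSubmonoid.zero_mem _
  | add x y _ _ hx hy => exact AddSubmonoid.add_mem _ hx hy

theorem ofLex_expo_zero (a b c : ℝ) : ofLex (expo a b c) 0 = a := by
  rw [ofLex_expo_apply]; simp

theorem ofLex_expo_one (a b c : ℝ) : ofLex (expo a b c) 1 = b := by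
  rw [ofLex_expo_apply]; simp

theorem ofLex_expo_two (a b c : ℝ) : ofLex (expo a b c) 2 = c := by
  rw [ofLex_expo_apply]; simp

theorem leadExp_expo (a b x y z : ℝ) :
    leadExp a b (expo x y z) = expo (a * x) (b * x + y) z := by
  rw [leadExp, ofLex_expo_zero, expo_add]
  congr 1 <;> ring

/-- Series whose exponents are `(x ℓ^(-μ))^γ ℓ^r ℓ₂^s` with `γ` in a discrete set. -/
theorem mem_LInfty_of_support {f : Transseries} {j : ℕ} (hj : j ≤ 2) {μ : ℝ} {T : Set ℝ}
    (hT : ∀ B, (T ∩ Set.Iic B).Finite)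
    (hf : ∀ n ∈ f.support, ∃ γ ∈ T, ∃ r s : ℤ, n = expo γ (-μ * γ + r) s)
    (hdepth : ∀ n ∈ f.support, ∀ k, j < k → ofLex n k = 0) : f ∈ LInfty j := by
  refine mem_LInfty hdepth (fun B => (hT B).subset ?_) fun k hk1 hkj p => ?_
  · rintro _ ⟨⟨n, hn, rfl⟩, hB⟩
    obtain ⟨γ, hγ, r, s, rfl⟩ := hf n hn
    rw [ofLex_expo_zero] at hB ⊢
    exact ⟨hγ, hB⟩
  · obtain rfl | rfl : k = 1 ∨ k = 2 := by omega
    · refine ⟨-μ * p 0, fun n hn hp => ?_⟩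
      obtain ⟨γ, hγ, r, s, rfl⟩ := hf n hn
      exact ⟨r, by rw [← hp 0 one_pos, ofLex_expo_zero, ofLex_expo_one]⟩
    · refine ⟨0, fun n hn _ => ?_⟩
      obtain ⟨γ, hγ, r, s, rfl⟩ := hf n hn
      exact ⟨s, by rw [ofLex_expo_two, zero_add]⟩

theorem finite_below_image {T : Set ℝ} (hT : ∀ B, (T ∩ Set.Iic B).Finite) (c : ℝ) {d : ℝ}
    (hd : 0 < d) (B : ℝ) : (((fun t => c + d * t) '' T) ∩ Set.Iic B).Finite := by
  refine ((hT ((B - c) / d)).image fun t => c + d * t).subset ?_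
  rintro _ ⟨⟨t, ht, rfl⟩, hB⟩
  refine ⟨t, ⟨ht, ?_⟩, rfl⟩
  rw [Set.mem_Iic] at hB ⊢
  rw [le_div_iff₀ hd]
  linarith

end Support

/-! ### The inverse and its support in terms of the semigroups -/

section Inverse

variable {g : Transseries} {α : ℝ} {m : ℤ}

theorem expo_zero_one_neg_one_pos : 0 < expo 0 1 (-1) := by
  have := ellExp_add_ellExp_succ_pos 1 one_pos (-1)
  rwa [expo, ellExp_zero, zero_add]

theorem ellExp_one_eq (r : ℝ) : ellExp 1 r = expo 0 r 0 := by
  rw [expo, ellExp_zero, ellExp_zero, zero_add, add_zero]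

theorem ellExp_two_eq (r : ℝ) : ellExp 2 r = expo 0 0 r := by
  rw [expo, ellExp_zero, ellExp_zero, zero_add, zero_add]

theorem expo_self_zero : expo 0 0 0 = 0 := by
  rw [← ellExp_one_eq, ellExp_zero]

/-- The generated monoid exceeds the generated semigroup at most by `0`, which belongs to the
leading term and does not occur in the remainder. -/
theorem mem_semigroup_of_mem_closure (hg : g ∈ LHat) (horder : g.order = expo α m 0)
    {q : Exponent} (hq : q ∈ AddSubmonoid.closure (relExp g ∪ {expo 0 1 (-1), expo 0 0 1})) :
    q = 0 ∨ ∃ γ : ℝ, ∃ r s : ℤ, (γ, r, s) ∈ semigroup g α m ∧ q = expo γ r s := by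
  induction hq using AddSubmonoid.closure_induction with
  | mem x hx =>
    right
    rcases hx with hx | rfl | rfl
    · obtain ⟨p, hp, rfl⟩ := exists_mem_supp_of_mem_relExp hg horder hx
      exact ⟨_, _, 0, AddSubsemigroup.subset_closure (Or.inl ⟨p, hp, rfl⟩), by
        rw [Int.cast_zero]⟩
    · exact ⟨0, 1, -1, AddSubsemigroup.subset_closure (Or.inr (Or.inl rfl)), by
        push_cast; rfl⟩
    · exact ⟨0, 0, 1, AddSubsemigroup.subset_closure (Or.inr (Or.inr rfl)), by
        push_cast; rfl⟩
  | zero => exact Or.inl rfl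
  | add x y _ _ hx hy =>
    rcases hx with rfl | ⟨γ, r, s, hx, rfl⟩
    · rwa [zero_add]
    rcases hy with rfl | ⟨γ', r', s', hy, rfl⟩
    · rw [add_zero]; exact Or.inr ⟨γ, r, s, hx, rfl⟩
    · refine Or.inr ⟨γ + γ', r + r', s + s', AddSubsemigroup.add_mem _ hx hy, ?_⟩
      rw [expo_add]; push_cast; rfl

theorem mem_semigroupZero_of_mem_closure (hg : g ∈ LHat) (horder : g.order = expo α (0 : ℤ) 0)
    {q : Exponent} (hq : q ∈ AddSubmonoid.closure (relExp g ∪ {expo 0 1 0})) :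
    q = 0 ∨ ∃ γ : ℝ, ∃ r : ℤ, (γ, r) ∈ semigroupZero g α ∧ q = expo γ r 0 := by
  induction hq using AddSubmonoid.closure_induction with
  | mem x hx =>
    right
    rcases hx with hx | rfl
    · obtain ⟨p, hp, rfl⟩ := exists_mem_supp_of_mem_relExp hg horder hx
      exact ⟨_, _, AddSubsemigroup.subset_closure (Or.inl ⟨p, hp, rfl⟩), by rw [sub_zero]⟩
    · exact ⟨0, 1, AddSubsemigroup.subset_closure (Or.inr rfl), by push_cast; rfl⟩
  | zero => exact Or.inl rfl
  | add x y _ _ hx hy =>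
    rcases hx with rfl | ⟨γ, r, hx, rfl⟩
    · rwa [zero_add]
    rcases hy with rfl | ⟨γ', r', hy, rfl⟩
    · rw [add_zero]; exact Or.inr ⟨γ, r, hx, rfl⟩
    · refine Or.inr ⟨γ + γ', r + r', AddSubsemigroup.add_mem _ hx hy, ?_⟩
      rw [expo_add, add_zero]; push_cast; rfl

theorem leadingCoeff_inverse_eq {a : ℝ} (ha : 0 < a) (hα : 0 < α) (m : ℤ) :
    (a ^ α⁻¹ * α⁻¹ ^ (-(m : ℝ) / α))⁻¹ = (a * α ^ m) ^ (-1 / α) := by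
  rw [Real.mul_rpow ha.le (zpow_pos hα m).le, ← Real.rpow_intCast, ← Real.rpow_mul hα.le, mul_inv,
    ← Real.rpow_neg ha.le, ← Real.inv_rpow (inv_pos.2 hα).le, inv_inv]
  congr 2 <;> ring

/-- The inverse of `g` and its properties, for a suitable monoid of exponents. -/
theorem exists_inverse_of_submonoid (hg : g ∈ LHat) (G : HasLeading g α m) {E : Set Exponent}
    (hE : E.Finite) (hE0 : ∀ q ∈ E, 0 ≤ q) (hE1 : ∀ q ∈ E, ofLex q 0 = 0) {j : ℕ} (hj : j ≤ 2)
    (h1 : relRem (ellComp g 1) ∈ supportedIn (AddSubmonoid.closure (relExp g ∪ E)))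
    (h2 : (∀ t ∈ AddSubmonoid.closure (relExp g ∪ E), ofLex t 2 = 0) ∨
      relRem (ellComp g 2) ∈ supportedIn (AddSubmonoid.closure (relExp g ∪ E)))
    (hM : ∀ q ∈ AddSubmonoid.closure (relExp g ∪ E), ∃ γ : ℝ, ∃ r s : ℤ, q = expo γ r s ∧
      (j = 1 → s = 0)) (hj1 : 1 ≤ j) :
    ∃ h : Transseries, IsFormalInverse g h ∧ (∀ h', IsFormalInverse g h' → h' = h) ∧
      (∀ n ∈ h.support, 0 < ofLex n 0) ∧ h ∈ LInfty j ∧ relRem h ∈ LInfty j ∧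
      h = HahnSeries.single (expo (1 / α) (-m / α) 0) ((g.leadingCoeff * α ^ m) ^ (-1 / α)) *
        (1 + relRem h) ∧
      0 < (relRem h).orderTop ∧
      ∀ n ∈ (relRem h).support, ∃ q ∈ AddSubmonoid.closure (relExp g ∪ E), q ≠ 0 ∧
        n = leadExp α⁻¹ (-m / α) q := by
  obtain ⟨hPWO, hnonneg⟩ := isPWO_closure_relExp_union (g := g) hE hE0
  have h0 : relRem g ∈ supportedIn (AddSubmonoid.closure (relExp g ∪ E)) :=
    relRem_mem_of_relExp G.ne_zero fun q hq => AddSubmonoid.subset_closure (Or.inl hq)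
  have hfin := finite_below_closure_relExp_union hg hE1
  set M := AddSubmonoid.closure (relExp g ∪ E) with hMdef
  have hM00 : ∀ q ∈ M, 0 ≤ ofLex q 0 := fun q hq => by
    rcases (hnonneg q hq).eq_or_lt with h | h
    · rw [← h]; exact le_rfl
    · obtain ⟨i, hi, hlt⟩ := exponent_lt_iff.1 h
      rcases Nat.eq_zero_or_pos i with rfl | hi0
      · exact hlt.le
      · exact (hi 0 hi0).le
  obtain ⟨h, hinv, hlc, hord, hsupp⟩ := G.exists_left_inverse hPWO hnonneg h0 h1 h2
  rw [leadingCoeff_inverse_eq G.leadingCoeff_pos G.pos] at hlc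
  have H : HasLeading h α⁻¹ (-m / α) :=
    ⟨by rw [hlc]; exact Real.rpow_pos_of_pos (mul_pos G.leadingCoeff_pos (zpow_pos G.pos m)) _,
      hord, inv_pos.2 G.pos⟩
  have hR := support_relRem_of_support (ψ := leadExp α⁻¹ (-m / α)) H.ne_zero (leadExp_zero _ _)
    (M := M) (by rwa [hord])
  -- The exponent of `ℓ` is an integer plus `-m` times the exponent of `x`; this is the coset
  -- condition for membership in `LInfty`. The coset varies with the exponent of `x`.
  have hRform : ∀ n ∈ (relRem h).support, ∃ γ : ℝ, ∃ r s : ℤ, (j = 1 → s = 0) ∧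
      (∃ q ∈ M, ofLex q 0 = γ) ∧ n = expo (α⁻¹ * γ) (-m * (α⁻¹ * γ) + r) s := fun n hn => by
    obtain ⟨q, hq, -, rfl⟩ := hR n hn
    obtain ⟨γ, r, s, rfl, hs⟩ := hM q hq
    refine ⟨γ, r, s, hs, ⟨_, hq, ofLex_expo_zero _ _ _⟩, ?_⟩
    rw [leadExp_expo]; congr 1; ring
  have hhform : ∀ n ∈ h.support, ∃ γ : ℝ, ∃ r s : ℤ, (j = 1 → s = 0) ∧
      (∃ q ∈ M, ofLex q 0 = γ) ∧
        n = expo (α⁻¹ + α⁻¹ * γ) (-m * (α⁻¹ + α⁻¹ * γ) + r) s := fun n hn => by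
    obtain ⟨q, hq, rfl⟩ := hsupp n hn
    obtain ⟨γ, r, s, rfl, hs⟩ := hM q hq
    refine ⟨γ, r, s, hs, ⟨_, hq, ofLex_expo_zero _ _ _⟩, ?_⟩
    rw [leadExp_expo, expo_add, zero_add]; congr 1; ring
  have hdepth : ∀ (a b : ℝ) (s : ℤ), (j = 1 → s = 0) → ∀ k, j < k →
      ofLex (expo a b s) k = 0 := fun a b s hs k hk => by
    rw [ofLex_expo_apply, if_neg (by omega), if_neg (by omega)]
    split_ifs with h2k
    · rw [hs (by omega)]; simp
    · simp
  have hdepthh : ∀ n ∈ h.support, ∀ k, j < k → ofLex n k = 0 := fun n hn => by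
    obtain ⟨γ, r, s, hs, -, rfl⟩ := hhform n hn
    exact hdepth _ _ _ hs
  have hI : IsFormalInverse g h := isFormalInverse_of_hom_eq G H (fun n hn k hk =>
    hg.1.1.1 n hn k hk) (fun n hn k hk => hdepthh n hn k (by omega)) hinv
  -- Uniqueness uses only that `h' ∘ g` is the identity.
  refine ⟨h, hI, fun h' h'I => h'I.2.left_unique G hI.2, fun n hn => ?_, ?_, ?_, ?_,
    orderTop_relRem_pos H.ne_zero, hR⟩
  · obtain ⟨γ, r, s, -, ⟨q, hq, rfl⟩, rfl⟩ := hhform n hn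
    rw [ofLex_expo_zero]
    have := hM00 q hq
    have := G.pos
    positivity
  · refine mem_LInfty_of_support hj (finite_below_image hfin α⁻¹ (inv_pos.2 G.pos)) (μ := m)
      (fun n hn => ?_) hdepthh
    obtain ⟨γ, r, s, -, hγ, rfl⟩ := hhform n hn
    exact ⟨_, ⟨γ, hγ, rfl⟩, r, s, rfl⟩
  · refine mem_LInfty_of_support hj (finite_below_image hfin 0 (inv_pos.2 G.pos)) (μ := m)
      (fun n hn => ?_) fun n hn => ?_
    · obtain ⟨γ, r, s, -, hγ, rfl⟩ := hRform n hn
      exact ⟨_, ⟨γ, hγ, zero_add _⟩, r, s, rfl⟩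
    · obtain ⟨γ, r, s, hs, -, rfl⟩ := hRform n hn
      exact hdepth _ _ _ hs
  · conv_lhs => rw [eq_single_mul_one_add_relRem H.ne_zero]
    rw [hord, hlc, one_div]

theorem mem_LInfty_two_of_one {f : Transseries} (hf : f ∈ LInfty 1) : f ∈ LInfty 2 := by
  refine ⟨fun n hn k hk => hf.1 n hn k (by omega), fun k hk p => ?_⟩
  rcases Nat.lt_or_ge k 2 with h | h
  · exact hf.2 k (by omega) p
  · refine isSequential_of_finite_below fun B => (Set.finite_singleton (0 : ℝ)).subset ?_
    rintro t ⟨⟨n, hn, -, rfl⟩, -⟩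
    exact hf.1 n hn k (by omega)

end Inverse

end LogTransseries

end

/-! ### The two cases of the theorem -/

open LogTransseries in
theorem proposition5p1 (g : Transseries) (hg : g ∈ LHat) (a α : ℝ) (m : ℤ)
    (ha : 0 < a) (hα : 0 < α)
    (hcoeff : g.leadingCoeff = a) (horder : g.order = expo α m 0) :
    ∃ ginv : Transseries,
      IsFormalInverse g ginv ∧
      (∀ h : Transseries, IsFormalInverse g h → h = ginv) ∧
      ginv ∈ LFin 2 ∧
      (m = 0 → ginv ∈ LHat) ∧
      (m ≠ 0 → ∃ R ∈ LInfty 2,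
        ginv = HahnSeries.single (expo (1 / α) (-m / α) 0) ((a * α ^ m) ^ (-1 / α)) * (1 + R) ∧
        0 < R.orderTop ∧
        ∀ n ∈ R.support, ∃ γ : ℝ, ∃ r s : ℤ, (γ, r, s) ∈ semigroup g α m ∧
          n = expo (γ / α) (-m * (γ / α) + r) s) ∧
      (m = 0 → ∃ R ∈ LHatInfty,
        ginv = HahnSeries.single (expo (1 / α) 0 0) (a ^ (-1 / α)) * (1 + R) ∧
        0 < R.orderTop ∧
        ∀ n ∈ R.support, ∃ γ : ℝ, ∃ r : ℤ, (γ, r) ∈ semigroupZero g α ∧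
          n = expo (γ / α) r 0) := by
  have G : HasLeading g α m := ⟨hcoeff ▸ ha, horder, hα⟩
  by_cases hm : m = 0
  · subst hm
    have hsub : relExp g ∪ {expo 0 1 0} ⊆ AddSubmonoid.closure (relExp g ∪ {expo 0 1 0}) :=
      AddSubmonoid.subset_closure
    have hM : ∀ q ∈ AddSubmonoid.closure (relExp g ∪ {expo 0 1 0}), ∃ γ : ℝ, ∃ r : ℤ,
        q = expo γ r 0 := fun q hq => by
      rcases mem_semigroupZero_of_mem_closure hg horder hq with rfl | ⟨γ, r, -, h⟩
      · exact ⟨0, 0, by rw [Int.cast_zero, expo_self_zero]⟩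
      · exact ⟨γ, r, h⟩
    have h1 : relRem (ellComp g 1) ∈ supportedIn (AddSubmonoid.closure (relExp g ∪ {expo 0 1 0})) :=
      G.relRem_ellComp_one_mem (relRem_mem_of_relExp G.ne_zero fun q hq => hsub (Or.inl hq))
        (by rw [ellExp_one_eq]; exact hsub (Or.inr rfl)) (Or.inl Int.cast_zero)
    obtain ⟨h, hI, hU, hpos, hL, hRL, heq, hR0, hR⟩ := exists_inverse_of_submonoid hg G
      (Set.finite_singleton (expo 0 1 0))
      (by rintro q rfl; rw [← ellExp_one_eq]; exact (ellExp_pos 1 one_pos).le)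
      (by rintro q rfl; exact ofLex_expo_zero _ _ _) (j := 1) one_le_two h1
      -- For `m = 0` the monoid has no `ℓ₂`, so the remainder of `ℓ₂ ∘ g` needs no control.
      (Or.inl fun t ht => by
        obtain ⟨γ, r, rfl⟩ := hM t ht
        exact ofLex_expo_two _ _ _)
      (fun q hq => by
        obtain ⟨γ, r, h⟩ := hM q hq
        exact ⟨γ, r, 0, by rw [h, Int.cast_zero], fun _ => rfl⟩) le_rfl
    rw [hcoeff, zpow_zero, mul_one, Int.cast_zero, neg_zero, zero_div] at heq
    have hR' : ∀ n ∈ (relRem h).support, ∃ γ : ℝ, ∃ r : ℤ, (γ, r) ∈ semigroupZero g α ∧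
        n = expo (γ / α) r 0 := fun n hn => by
      obtain ⟨q, hq, hq0, rfl⟩ := hR n hn
      obtain ⟨γ, r, hs, rfl⟩ := (mem_semigroupZero_of_mem_closure hg horder hq).resolve_left hq0
      refine ⟨γ, r, hs, ?_⟩
      rw [leadExp_expo, Int.cast_zero, neg_zero, zero_div, zero_mul, zero_add, div_eq_inv_mul]
    refine ⟨h, hI, hU, ⟨mem_LInfty_two_of_one hL, hpos⟩, fun _ => ⟨⟨hL, hpos⟩, fun n hn => ?_⟩,
      fun h0 => absurd rfl h0, fun _ => ⟨relRem h, ⟨hRL, fun n hn => ?_⟩, heq, hR0, hR'⟩⟩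
    · rw [heq] at hn
      obtain ⟨p, hp, t, ht, rfl⟩ := HahnSeries.support_mul_subset hn
      rw [HahnSeries.eq_of_mem_support_single hp, ofLex_add_apply, ofLex_expo_one]
      rcases HahnSeries.support_add_subset _ _ ht with ht | ht
      · rw [HahnSeries.support_one, Set.mem_singleton_iff] at ht
        exact ⟨0, by rw [ht]; simp⟩
      · obtain ⟨γ, r, -, rfl⟩ := hR' t ht
        exact ⟨r, by rw [ofLex_expo_one, zero_add]⟩
    · obtain ⟨γ, r, -, rfl⟩ := hR' n hn
      exact ⟨r, ofLex_expo_one _ _ _⟩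
  · have hsub : relExp g ∪ {expo 0 1 (-1), expo 0 0 1} ⊆
        AddSubmonoid.closure (relExp g ∪ {expo 0 1 (-1), expo 0 0 1}) :=
      AddSubmonoid.subset_closure
    have he1 : expo 0 1 (-1) ∈ AddSubmonoid.closure (relExp g ∪ {expo 0 1 (-1), expo 0 0 1}) :=
      hsub (Or.inr (Or.inl rfl))
    have he2 : expo 0 0 1 ∈ AddSubmonoid.closure (relExp g ∪ {expo 0 1 (-1), expo 0 0 1}) :=
      hsub (Or.inr (Or.inr rfl))
    have h1 : relRem (ellComp g 1) ∈
        supportedIn (AddSubmonoid.closure (relExp g ∪ {expo 0 1 (-1), expo 0 0 1})) := by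
      refine G.relRem_ellComp_one_mem
        (relRem_mem_of_relExp G.ne_zero fun q hq => hsub (Or.inl hq)) ?_ (Or.inr ?_)
      -- The monomial `ℓ` is the product of the generators `ℓ ℓ₂⁻¹` and `ℓ₂`.
      · have := AddSubmonoid.add_mem _ he1 he2
        rw [expo_add] at this
        rw [ellExp_one_eq]
        convert this using 2 <;> norm_num
      · rw [ellExp_one_eq, ellExp_two_eq, expo_add]
        convert he1 using 2 <;> norm_num
    have h2 : relRem (ellComp g 2) ∈
        supportedIn (AddSubmonoid.closure (relExp g ∪ {expo 0 1 (-1), expo 0 0 1})) :=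
      G.relRem_ellComp_succ_succ_mem h1 (by rw [zero_add, ellExp_two_eq]; exact he2)
    obtain ⟨h, hI, hU, hpos, hL, hRL, heq, hR0, hR⟩ := exists_inverse_of_submonoid hg G
      (Set.toFinite {expo 0 1 (-1), expo 0 0 1})
      (by
        rintro q (rfl | rfl)
        · exact expo_zero_one_neg_one_pos.le
        · rw [← ellExp_two_eq]; exact (ellExp_pos 2 one_pos).le)
      (by rintro q (rfl | rfl) <;> exact ofLex_expo_zero _ _ _) (j := 2) le_rfl h1 (Or.inr h2)
      (fun q hq => by
        rcases mem_semigroup_of_mem_closure hg horder hq with rfl | ⟨γ, r, s, -, h⟩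
        · exact ⟨0, 0, 0, by rw [Int.cast_zero, expo_self_zero], fun _ => rfl⟩
        · exact ⟨γ, r, s, h, fun h0 => absurd h0 (by norm_num)⟩) one_le_two
    rw [hcoeff] at heq
    refine ⟨h, hI, hU, ⟨hL, hpos⟩, fun h0 => absurd h0 hm,
      fun _ => ⟨relRem h, hRL, heq, hR0, fun n hn => ?_⟩, fun h0 => absurd h0 hm⟩
    obtain ⟨q, hq, hq0, rfl⟩ := hR n hn
    obtain ⟨γ, r, s, hs, rfl⟩ := (mem_semigroup_of_mem_closure hg horder hq).resolve_left hq0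
    refine ⟨γ, r, s, hs, ?_⟩
    rw [leadExp_expo]
    congr 1 <;> ring
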